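/- Let $p:\mathcal{X}\to\mathcal{S}$ be a functor. The fiber $p^A$ over an object $A$ of $\mathcal{S}$ consists of the objects over $A$ and the morphisms over $\mathrm{id}_A$. A morphism $q:Q\to R$ over $g:B\to C$ is *cartesian* if for every $f:A\to B$ and every $r:P\to R$ over $gf$ there is a unique $s:P\to Q$ over $f$ with $qs=r$; *cocartesian* is the dual notion. The functor $p$ is a *fibration* if every $g:B\to C$ has a cartesian lift with any prescribed codomain over $C$. It is a *$\wedge$-fibration* if moreover every fiber has a terminal object and binary products, and these are stable under pullback along cartesian morphisms. A morphism $q:Q\to Q'$ over $f:A\to B$ *satisfies Frobenius reciprocity* if for every cartesian $c:P_0\to P$ over $f$ and all products $Q\wedge P_0$ and $Q'\wedge P$ in the fibers over $A$ and $B$, the induced morphism $q\wedge c:Q\wedge P_0\to Q'\wedge P$ over $f$ is cocartesian. A morphism $q:P\to Q$ over $g:C\to D$ is *stable along* $k:B\to D$ if for every pullback square $kf=gh$ in $\mathcal{S}$ and every commutative square $tq'=qs$ over it, with $s$ over $h$ and $t$ over $k$ cartesian, the morphism $q'$ (over $f$) is cocartesian. A *generalized diagonal* is a pullback of a diagonal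 morphism $Y\to Y\times Y$ along a product projection. A *$\wedge_=$-fibration* is a $\wedge$-fibration whose base has finite products, such that every generalized diagonal has a cocartesian lift with domain any terminal object of the fiber over its domain, and every such lift satisfies Frobenius reciprocity and is stable along all product projections. Let $\mathcal{C}$ be a model category (with finite limits and colimits; functorial factorizations are not required). Let $\mathcal{C}^\to$ be its arrow category, with codomain functor $\mathcal{C}^\to\to\mathcal{C}$. Let $\mathrm{Ho}(\mathcal{C}^\to)$ be the localization of $\mathcal{C}^\to$ at the vertical weak equivalences, i.e. the morphisms $(w,\mathrm{id}_A):(X\to A)\to(Y\to A)$ with $w$ a weak equivalence; it has the same objects as $\mathcal{C}^\to$ and carries an induced functor to $\mathcal{C}$. Let $\mathcal{C}_{fb}$ be the full subcategory of fibrant objects of $\mathcal{C}$, and let $\mathrm{HoF}_{fb}(\mathcal{C}_{fb})$ be the restriction of this functor to the full subcategory of $\mathrm{Ho}(\mathcal{C}^\to)$ on the fibrations $x:X\to A$ with $A$ fibrant, regarded as a functor to $\mathcal{C}_{fb}$. Let $\gamma$ denote the localization functor restricted to these objects. **Theorem.** Suppose that $\mathcal{C}$ is right proper, i.e. that weak equivalences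 are stable under pullback along fibrations. Then $\mathrm{HoF}_{fb}(\mathcal{C}_{fb})$ is a $\wedge_=$-fibration. Moreover: 1. For every fibrant $A$, the canonical functor from the category $(\mathcal{C}/A)_{fb}$ of fibrant objects of the slice model category to the fiber of $\mathrm{HoF}_{fb}(\mathcal{C}_{fb})$ over $A$ is a localization at the weak equivalences, i.e. the fiber is the homotopy category of the fibrant objects of $\mathcal{C}/A$. 2. For every morphism $f:A\to B$ of fibrant objects and every fibration $P=(X\to A)$ there are a fibration $Q=(Y\to B)$ and a morphism $(\hat f,f):P\to Q$ of $\mathcal{C}^\to$ with $\hat f$ a weak equivalence such that $\gamma(\hat f,f)$ is a cocartesian lift of $f$. 3. For every morphism $(\hat f,f)$ of $\mathcal{C}^\to$ between fibrations over fibrant objects, $\gamma(\hat f,f)$ is cocartesian if and only if $\hat f$ is a weak equivalence. 4. Every cocartesian morphism of $\mathrm{HoF}_{fb}(\mathcal{C}_{fb})$ satisfies Frobenius reciprocity and is stable along every product projection of $\mathcal{C}_{fb}$. -/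

import Mathlib

open CategoryTheory CategoryTheory.Limits HomotopicalAlgebra

universe v u v₁ u₁ v₂ u₂

/-! ## Fibrations with fiberwise finite products and equality objects

Throughout, `p : 𝒳 ⥤ 𝒮` is a functor ("prefibration").  "Cartesian" and "cocartesian" mean having
the universal property with respect to lifts of all composites, which is Mathlib's
`IsStronglyCartesian` and `IsStronglyCocartesian`. -/

namespace WedgeFib

section Base

variable {D : Type u₁} [Category.{v₁} D]

/-- `π₂ : Z ⟶ Y` is the second leg of some binary product diagram `X ⟵ Z ⟶ Y`. -/
def IsProductProjection {Z Y : D} (π₂ : Z ⟶ Y) : Prop :=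
  ∃ (X : D) (π₁ : Z ⟶ X), Nonempty (IsLimit (BinaryFan.mk π₁ π₂))

/-- `Δ : Y ⟶ Z` is a diagonal morphism `Y ⟶ Y × Y`. -/
def IsDiagonal {Y Z : D} (Δ : Y ⟶ Z) : Prop :=
  ∃ π₁ π₂ : Z ⟶ Y, Nonempty (IsLimit (BinaryFan.mk π₁ π₂)) ∧ Δ ≫ π₁ = 𝟙 Y ∧ Δ ≫ π₂ = 𝟙 Y

/-- `d : W ⟶ V` is a generalized diagonal `id × Δ : X × Y ⟶ X × Y × Y`, i.e. a pullback of a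
diagonal morphism along a product projection. -/
def IsGeneralizedDiagonal {W V : D} (d : W ⟶ V) : Prop :=
  ∃ (Y Z : D) (Δ : Y ⟶ Z) (π₂' : W ⟶ Y) (π₂ : V ⟶ Z),
    IsDiagonal Δ ∧ IsProductProjection π₂ ∧ IsPullback d π₂' π₂ Δ

end Base

variable {𝒮 : Type u₁} {𝒳 : Type u₂} [Category.{v₁} 𝒮] [Category.{v₂} 𝒳]

/-- A `∧`-fibration: a fibration whose fibers have finite products (a terminal object and binary
products), stable under pullback along cartesian morphisms. -/
structure IsWedgeFibration (p : 𝒳 ⥤ 𝒮) : Prop where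
  isFibered : p.IsFibered
  fiber_hasTerminal (A : 𝒮) : HasTerminal (p.Fiber A)
  fiber_hasBinaryProducts (A : 𝒮) : HasBinaryProducts (p.Fiber A)
  terminal_stable {A B : 𝒮} (f : A ⟶ B) (T' : p.Fiber A) (T : p.Fiber B) (c : T'.1 ⟶ T.1)
    (hc : p.IsStronglyCartesian f c) (hT : Nonempty (IsTerminal T)) : Nonempty (IsTerminal T')
  product_stable {A B : 𝒮} (f : A ⟶ B) {P Q R : p.Fiber B} {P' Q' R' : p.Fiber A}
    (π₁ : R ⟶ P) (π₂ : R ⟶ Q) (π₁' : R' ⟶ P') (π₂' : R' ⟶ Q')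
    (cP : P'.1 ⟶ P.1) (cQ : Q'.1 ⟶ Q.1) (cR : R'.1 ⟶ R.1)
    (hP : p.IsStronglyCartesian f cP) (hQ : p.IsStronglyCartesian f cQ)
    (hR : p.IsStronglyCartesian f cR)
    (comm₁ : Functor.Fiber.fiberInclusion.map π₁' ≫ cP = cR ≫ Functor.Fiber.fiberInclusion.map π₁)
    (comm₂ : Functor.Fiber.fiberInclusion.map π₂' ≫ cQ = cR ≫ Functor.Fiber.fiberInclusion.map π₂)
    (hlim : Nonempty (IsLimit (BinaryFan.mk π₁ π₂))) :
    Nonempty (IsLimit (BinaryFan.mk π₁' π₂'))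

/-- Stability along `k : B ⟶ D` (Beck–Chevalley) of a morphism `q : P ⟶ Q` over `g : C ⟶ D`, to be
used for cocartesian `q`: for each pullback square in the base with sides `g` and `k`, and each
commutative square over it with bottom `q` and cartesian sides `s`, `t`, the top `q'` is
cocartesian. -/
def IsStableAlong (p : 𝒳 ⥤ 𝒮) {C D : 𝒮} (g : C ⟶ D) {P Q : 𝒳} (q : P ⟶ Q)
    {B : 𝒮} (k : B ⟶ D) : Prop :=
  ∀ {A : 𝒮} (f : A ⟶ B) (h : A ⟶ C), IsPullback f h k g →
    ∀ {P' Q' : 𝒳} (q' : P' ⟶ Q') (s : P' ⟶ P) (t : Q' ⟶ Q),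
      p.IsHomLift f q' → p.IsStronglyCartesian h s → p.IsStronglyCartesian k t →
      q' ≫ t = s ≫ q → p.IsStronglyCocartesian f q'

/-- Frobenius reciprocity for a morphism `q : Q ⟶ Q'` over `f : A ⟶ B`, to be used for cocartesian
`q`: whenever `c : P₀ ⟶ P` is cartesian over `f` and `R`, `R'` are products `Q ∧ P₀`, `Q' ∧ P` in the
fibers, the morphism `q ∧ c : R ⟶ R'` over `f` is cocartesian. -/
def SatisfiesFrobenius (p : 𝒳 ⥤ 𝒮) {A B : 𝒮} (f : A ⟶ B) {Q : p.Fiber A} {Q' : p.Fiber B}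
    (q : Q.1 ⟶ Q'.1) : Prop :=
  ∀ {P₀ R : p.Fiber A} {P R' : p.Fiber B} (c : P₀.1 ⟶ P.1)
    (π₁ : R ⟶ Q) (π₂ : R ⟶ P₀) (π₁' : R' ⟶ Q') (π₂' : R' ⟶ P) (r : R.1 ⟶ R'.1),
    p.IsStronglyCartesian f c →
    Nonempty (IsLimit (BinaryFan.mk π₁ π₂)) → Nonempty (IsLimit (BinaryFan.mk π₁' π₂')) →
    p.IsHomLift f r →
    r ≫ Functor.Fiber.fiberInclusion.map π₁' = Functor.Fiber.fiberInclusion.map π₁ ≫ q →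
    r ≫ Functor.Fiber.fiberInclusion.map π₂' = Functor.Fiber.fiberInclusion.map π₂ ≫ c →
    p.IsStronglyCocartesian f r

/-- A `∧₌`-fibration: a `∧`-fibration over a base with finite products, with cocartesian lifts of
generalized diagonals at terminal objects of the fibers, all of which satisfy Frobenius reciprocity
and are stable along product projections. -/
structure IsWedgeEqFibration (p : 𝒳 ⥤ 𝒮) : Prop where
  base_hasTerminal : HasTerminal 𝒮
  base_hasBinaryProducts : HasBinaryProducts 𝒮
  isWedgeFibration : IsWedgeFibration p
  exists_cocartesian {W V : 𝒮} (d : W ⟶ V) (hd : IsGeneralizedDiagonal d)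
    (T : p.Fiber W) (hT : Nonempty (IsTerminal T)) :
    ∃ (E : p.Fiber V) (ρ : T.1 ⟶ E.1), p.IsStronglyCocartesian d ρ
  frobenius {W V : 𝒮} (d : W ⟶ V) (hd : IsGeneralizedDiagonal d)
    (T : p.Fiber W) (hT : Nonempty (IsTerminal T)) (E : p.Fiber V) (ρ : T.1 ⟶ E.1)
    (hρ : p.IsStronglyCocartesian d ρ) : SatisfiesFrobenius p d ρ
  stable {W V : 𝒮} (d : W ⟶ V) (hd : IsGeneralizedDiagonal d)
    (T : p.Fiber W) (hT : Nonempty (IsTerminal T)) (E : p.Fiber V) (ρ : T.1 ⟶ E.1)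
    (hρ : p.IsStronglyCocartesian d ρ) {X : 𝒮} (k : X ⟶ V) (hk : IsProductProjection k) :
    IsStableAlong p d ρ k

end WedgeFib

/-! ## The fibration of homotopy categories of a model category -/

namespace HoFib

variable (C : Type u) [Category.{v} C] [ModelCategory C]

/-- Weak equivalences are stable under pullback along fibrations. -/
def RightProper : Prop :=
  ∀ {A B B' D : C} {w' : A ⟶ B} {g' : A ⟶ B'} {g : B ⟶ D} {w : B' ⟶ D},
    IsPullback w' g' g w → Fibration g → WeakEquivalence w → WeakEquivalence w'

/-- The vertical weak equivalences of the arrow category: morphisms `(p, 𝟙 A)` between arrows with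
the same codomain `A`, with `p` a weak equivalence. -/
def verticalWeakEquivalences : MorphismProperty (Arrow C) := fun P _ φ ↦
  (Arrow.rightFunc : Arrow C ⥤ C).IsHomLift (𝟙 P.right) φ ∧ WeakEquivalence φ.left

/-- `Ho(C^→)`: the localization of the arrow category at the vertical weak equivalences.  It has the
same objects as `C^→`. -/
abbrev HoArrow : Type (max u v) := (verticalWeakEquivalences C).Localization

lemma verticalWeakEquivalences_isInvertedBy_rightFunc :
    (verticalWeakEquivalences C).IsInvertedBy (Arrow.rightFunc : Arrow C ⥤ C) := by
  rintro P Q φ ⟨h, -⟩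
  rw [CategoryTheory.IsHomLift.fac' (Arrow.rightFunc : Arrow C ⥤ C) (𝟙 P.right) φ]
  infer_instance

/-- The prefibration `HoF : Ho(C^→) ⥤ C` induced by the codomain functor `C^→ ⥤ C`. -/
noncomputable def hoF : HoArrow C ⥤ C :=
  Localization.Construction.lift Arrow.rightFunc (verticalWeakEquivalences_isInvertedBy_rightFunc C)

/-- The arrows `X ⟶ A` that are fibrations and have fibrant codomain `A`. -/
def fibrantArrows : ObjectProperty (Arrow C) := fun P ↦
  Fibration P.hom ∧ IsFibrant P.right

/-- The full subcategory of `C^→` on the fibrations over fibrant objects. -/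
abbrev FibArrow : Type (max u v) := (fibrantArrows C).FullSubcategory

/-- The codomain functor from fibrations over fibrant objects to fibrant objects. -/
def codFib : FibArrow C ⥤ FibrantObject C :=
  (fibrantObjects C).lift ((fibrantArrows C).ι ⋙ Arrow.rightFunc) (fun P ↦ P.property.2)

/-- The full subcategory of `Ho(C^→)` on the fibrations over fibrant objects. -/
abbrev HoFibArrow : Type (max u v) :=
  ObjectProperty.FullSubcategory (C := HoArrow C) fun P ↦
    fibrantArrows C ((Localization.Construction.objEquiv (verticalWeakEquivalences C)).symm P)

/-- The prefibration `HoF_fb(C_fb)`: the restriction of `HoF` to the fibrations over fibrant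
objects. -/
noncomputable def hoFfb : HoFibArrow C ⥤ FibrantObject C :=
  (fibrantObjects C).lift (ObjectProperty.ι _ ⋙ hoF C) (fun P ↦ P.property.2)

/-- The canonical functor from the category of fibrations over fibrant objects to its homotopy
category, the restriction of the localization functor. -/
noncomputable def gammaFb : FibArrow C ⥤ HoFibArrow C :=
  ObjectProperty.lift _ ((fibrantArrows C).ι ⋙ (verticalWeakEquivalences C).Q) (fun P ↦ P.property)

lemma gammaFb_comp_hoFfb : gammaFb C ⋙ hoFfb C = codFib C := by
  refine CategoryTheory.Functor.hext (fun _ ↦ rfl) (fun P Q φ ↦ heq_of_eq ?_)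
  exact ObjectProperty.hom_ext _ (eq_of_heq (Functor.hcongr_hom (Localization.Construction.fac
    Arrow.rightFunc (verticalWeakEquivalences_isInvertedBy_rightFunc C)) φ.hom))

variable {C} in
lemma fibration_hom_of_isFibrant {A : C} (X : Over A) (hX : IsFibrant X) : Fibration X.hom :=
  (fibrations_over_iff A (Over.homMk X.hom : X ⟶ Over.mk (𝟙 A))).1
    ((isFibrant_iff_of_isTerminal _ Over.mkIdTerminal).1 hX)

variable {C} in
/-- The inclusion of the fibrant objects of the slice model category `C/A` into the category of
fibrations over fibrant objects, for `A` fibrant. -/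
def sliceInclusion (A : FibrantObject C) : FibrantObject (Over A.obj) ⥤ FibArrow C where
  obj X := ⟨Arrow.mk X.obj.hom, fibration_hom_of_isFibrant X.obj X.property, A.property⟩
  map {X Y} φ := ObjectProperty.homMk (Arrow.homMk φ.hom.left (𝟙 A.obj))

variable {C} in
lemma sliceInclusion_comp (A : FibrantObject C) :
    (sliceInclusion A ⋙ gammaFb C) ⋙ hoFfb C =
      (Functor.const (FibrantObject (Over A.obj))).obj A := by
  rw [Functor.assoc, gammaFb_comp_hoFfb]
  rfl

variable {C} in
/-- The canonical functor from the fibrant objects of `C/A` to the fiber of `HoF_fb(C_fb)` over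
`A`. -/
noncomputable def toFiber (A : FibrantObject C) : FibrantObject (Over A.obj) ⥤ (hoFfb C).Fiber A :=
  Functor.Fiber.inducedFunctor (sliceInclusion_comp A)

end HoFib

/-! ## The vertical model structure on the arrow category

The model structure on `Arrow C` whose weak equivalences are the morphisms `(w, e)` with `w` a weak
equivalence and `e` an isomorphism. -/

/-! Up to isomorphism, the vertical weak equivalences are the weak equivalences of a model structure
on `Arrow C` in which homotopies do not move the codomain. Its fibrant objects are the fibrations,
and an arrow is cofibrant when its domain is. Morphisms of the homotopy category out of a cofibrant
fibration `S` over a fibrant object are therefore homotopy classes of commutative squares over a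
fixed map of codomains.

Universal properties of squares in `Arrow C` thus pass to the homotopy category. For limits
(`existsUnique_family`), existence is the strict property at `S`, and uniqueness is the strict
property at a cylinder on `S`. Pullback squares become cartesian, identities become terminal in the
fibers, and fiber products become products. For cocartesian morphisms
(`existsUnique_of_weakEquivalence`), a trivial cofibration on domains lifts against fibrant objects
and against path objects, with the codomain part prescribed.

Factoring `P.hom ≫ f` as a trivial cofibration followed by a fibration therefore gives a cocartesian
lift. Conversely, any cocartesian class differs from this one by an isomorphism, and morphisms that
become isomorphisms are weak equivalences (`weakEquivalence_of_isIso_map`).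

Frobenius reciprocity and stability both ask that a weak equivalence on domains remain one after
pullback along a fibration, which is right properness. For stability, the fibration exists because a
product projection between fibrant objects is a fibration. The fibers are compared with the slices
through the same description of morphisms as homotopy classes. -/

namespace HoFib.VerticalModelStructure

variable {C : Type u} [Category.{v} C] [ModelCategory C]

/-- The morphisms with a cofibration as domain part. -/
scoped instance : CategoryWithCofibrations (Arrow C) where
  cofibrations := fun _ _ φ ↦ Cofibration φ.left

/-- The morphisms `P ⟶ Q` whose induced morphism from `P.left` to the pullback of `Q.hom` is a
fibration. -/
scoped instance : CategoryWithFibrations (Arrow C) where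
  fibrations := fun P Q φ ↦ Fibration (pullback.lift P.hom φ.left (Arrow.w φ).symm :
    P.left ⟶ pullback φ.right Q.hom)

/-- The morphisms `(w, e)` with `w` a weak equivalence and `e` an isomorphism. -/
scoped instance : CategoryWithWeakEquivalences (Arrow C) where
  weakEquivalences := fun _ _ φ ↦ WeakEquivalence φ.left ∧ IsIso φ.right

variable {P Q : Arrow C} (φ : P ⟶ Q)

lemma arrow_cofibration_iff : Cofibration φ ↔ Cofibration φ.left :=
  ⟨fun h ↦ h.mem, fun h ↦ ⟨h⟩⟩

lemma arrow_weakEquivalence_iff : WeakEquivalence φ ↔ WeakEquivalence φ.left ∧ IsIso φ.right :=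
  ⟨fun h ↦ h.mem, fun h ↦ ⟨h⟩⟩

lemma arrow_fibration_iff : Fibration φ ↔
    Fibration (pullback.lift P.hom φ.left (Arrow.w φ).symm : P.left ⟶ pullback φ.right Q.hom) :=
  ⟨fun h ↦ h.mem, fun h ↦ ⟨h⟩⟩

instance [h : WeakEquivalence φ] : WeakEquivalence φ.left := ((arrow_weakEquivalence_iff φ).1 h).1

instance [h : WeakEquivalence φ] : IsIso φ.right := ((arrow_weakEquivalence_iff φ).1 h).2

instance [h : Cofibration φ] : Cofibration φ.left := (arrow_cofibration_iff φ).1 h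

lemma fibration_comp_iso_iff {X Y Z : C} (f : X ⟶ Y) (e : Y ⟶ Z) [IsIso e] :
    Fibration (f ≫ e) ↔ Fibration f := by
  simp only [fibration_iff]
  exact MorphismProperty.cancel_right_of_respectsIso _ _ _

lemma arrow_fibration_iff_of_isIso_hom [IsIso Q.hom] : Fibration φ ↔ Fibration P.hom := by
  rw [arrow_fibration_iff, ← fibration_comp_iso_iff _ (pullback.fst φ.right Q.hom),
    pullback.lift_fst]

lemma arrow_fibration_iff_of_isIso_right [IsIso φ.right] : Fibration φ ↔ Fibration φ.left := by
  rw [arrow_fibration_iff, ← fibration_comp_iso_iff _ (pullback.snd φ.right Q.hom),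
    pullback.lift_snd]

/-- The terminal arrow is invertible, so the map from `P.left` to the pullback is `P.hom` up to
isomorphism. -/
lemma isFibrant_arrow_iff : IsFibrant P ↔ Fibration P.hom := by
  have : IsIso (⊤_ (Arrow C)).hom := by
    let t : Arrow C := Arrow.mk (𝟙 (⊤_ C))
    have ht : IsTerminal t := IsTerminal.ofUniqueHom
      (fun P ↦ Arrow.homMk (terminal.from _) (terminal.from _)
        (Subsingleton.elim (α := _ ⟶ ⊤_ C) _ _))
      (fun P m ↦ by ext <;> exact Subsingleton.elim (α := _ ⟶ ⊤_ C) _ _)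
    have e : t ≅ ⊤_ (Arrow C) := ht.uniqueUpToIso terminalIsTerminal
    have h := Arrow.w e.inv
    have h' : (⊤_ (Arrow C)).hom = e.inv.left ≫ e.hom.right := by
      rw [← cancel_mono e.inv.right, ← Arrow.w e.inv, Category.assoc]
      have : e.hom.right ≫ e.inv.right = 𝟙 _ := by rw [← Arrow.comp_right, e.hom_inv_id]; rfl
      rw [this]
      rfl
    rw [h']
    infer_instance
  exact arrow_fibration_iff_of_isIso_hom _

/-- A morphism with trivial cofibration as domain part lifts against fibrations of arrows as soon
as a lift of the codomain parts is given. -/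
lemma exists_lift_of_right {A B X Y : Arrow C} (i : A ⟶ B) (p : X ⟶ Y) [Cofibration i.left]
    [WeakEquivalence i.left] [Fibration p] (f : A ⟶ X) (g : B ⟶ Y) (w : f ≫ p = i ≫ g)
    (b : B.right ⟶ X.right) (hb : i.right ≫ b = f.right) (hb' : b ≫ p.right = g.right) :
    ∃ l : B ⟶ X, l.right = b ∧ i ≫ l = f ∧ l ≫ p = g := by
  have hp := (arrow_fibration_iff p).1 inferInstance
  have wl : f.left ≫ p.left = i.left ≫ g.left := congr_arg Arrow.Hom.left w
  have sq : CommSq f.left i.left (pullback.lift X.hom p.left (Arrow.w p).symm)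
      (pullback.lift (B.hom ≫ b) g.left (by rw [Category.assoc, hb', Arrow.w g])) := by
    constructor
    apply pullback.hom_ext
    · simp only [Category.assoc, pullback.lift_fst]
      rw [Arrow.w_assoc i, hb, Arrow.w f]
    · simpa only [Category.assoc, pullback.lift_snd] using wl
  have h₁ := sq.fac_right =≫ pullback.fst _ _
  have h₂ := sq.fac_right =≫ pullback.snd _ _
  simp only [Category.assoc, pullback.lift_fst, pullback.lift_snd] at h₁ h₂
  refine ⟨Arrow.homMk sq.lift b h₁, rfl, ?_, ?_⟩
  · ext
    · exact sq.fac_left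
    · exact hb
  · ext
    · exact h₂
    · exact hb'

instance : (weakEquivalences (Arrow C)).HasTwoOutOfThreeProperty := by
  have : weakEquivalences (Arrow C) = (weakEquivalences C).inverseImage Arrow.leftFunc ⊓
      (MorphismProperty.isomorphisms C).inverseImage Arrow.rightFunc := by
    ext P Q φ
    rw [← weakEquivalence_iff, arrow_weakEquivalence_iff, weakEquivalence_iff]
    rfl
  rw [this]
  infer_instance

instance : (weakEquivalences (Arrow C)).IsStableUnderRetracts := by
  have : weakEquivalences (Arrow C) = (weakEquivalences C).inverseImage Arrow.leftFunc ⊓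
      (MorphismProperty.isomorphisms C).inverseImage Arrow.rightFunc := by
    ext P Q φ
    rw [← weakEquivalence_iff, arrow_weakEquivalence_iff, weakEquivalence_iff]
    rfl
  rw [this]
  infer_instance

instance : (cofibrations (Arrow C)).IsStableUnderRetracts := by
  have : cofibrations (Arrow C) = (cofibrations C).inverseImage Arrow.leftFunc := by
    ext P Q φ
    rw [← cofibration_iff, arrow_cofibration_iff, cofibration_iff]
    rfl
  rw [this]
  infer_instance

instance {A B X Y : Arrow C} (i : A ⟶ B) (p : X ⟶ Y) [Cofibration i] [WeakEquivalence i]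
    [Fibration p] : HasLiftingProperty i p where
  sq_hasLift {f g} sq := by
    obtain ⟨l, -, h₁, h₂⟩ := exists_lift_of_right i p f g sq.w (inv i.right ≫ f.right) (by simp)
      (by
        have : f.right ≫ p.right = i.right ≫ g.right := congr_arg Arrow.Hom.right sq.w
        simp [this])
    exact ⟨⟨⟨l, h₁, h₂⟩⟩⟩

instance {A B X Y : Arrow C} (i : A ⟶ B) (p : X ⟶ Y) [Cofibration i] [Fibration p]
    [WeakEquivalence p] : HasLiftingProperty i p where
  sq_hasLift {f g} sq := by
    have hp : Fibration p.left := (arrow_fibration_iff_of_isIso_right p).1 inferInstance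
    have wl : f.left ≫ p.left = i.left ≫ g.left := congr_arg Arrow.Hom.left sq.w
    have wr : f.right ≫ p.right = i.right ≫ g.right := congr_arg Arrow.Hom.right sq.w
    have sq' : CommSq f.left i.left p.left g.left := ⟨wl⟩
    refine ⟨⟨⟨Arrow.homMk sq'.lift (g.right ≫ inv p.right) ?_, ?_, ?_⟩⟩⟩
    · rw [← cancel_mono p.right, Category.assoc, ← Arrow.w p, sq'.fac_right_assoc]
      simp
    · ext
      · exact sq'.fac_left
      · simp [← reassoc_of% wr]
    · ext
      · exact sq'.fac_right
      · simp

/-- Closure under retracts, awkward to see for maps into pullbacks, is automatic for a class defined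
by lifting. -/
lemma fibrations_arrow_eq_rlp : fibrations (Arrow C) = (trivialCofibrations (Arrow C)).rlp := by
  ext X Y p
  constructor
  · intro hp A B i hi
    have : Fibration p := ⟨hp⟩
    have : Cofibration i := ⟨hi.1⟩
    have : WeakEquivalence i := ⟨hi.2⟩
    infer_instance
  · intro hp
    rw [← fibration_iff, arrow_fibration_iff, fibration_iff, ← trivialCofibrations_rlp]
    intro A B i hi
    refine ⟨fun {f g} sq ↦ ?_⟩
    -- A lifting problem in `C` against the map into the pullback becomes one in `Arrow C` by
    -- regarding `i` as a map of arrows over `X.right`.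
    let b : B ⟶ X.right := g ≫ pullback.fst _ _
    let i' : Arrow.mk (i ≫ b) ⟶ Arrow.mk b := Arrow.homMk i (𝟙 _) (by simp)
    have hi' : trivialCofibrations (Arrow C) i' :=
      ⟨⟨hi.1⟩, ⟨hi.2⟩, (inferInstance : IsIso (𝟙 X.right))⟩
    have := hp _ hi'
    have h₁ := sq.w =≫ pullback.fst _ _
    have h₂ := sq.w =≫ pullback.snd _ _
    simp only [Category.assoc, pullback.lift_fst, pullback.lift_snd] at h₁ h₂
    let f' : Arrow.mk (i ≫ b) ⟶ X := Arrow.homMk f (𝟙 _) (by simp [b, h₁])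
    let g' : Arrow.mk b ⟶ Y := Arrow.homMk (g ≫ pullback.snd _ _) p.right
      (by simp [b, pullback.condition])
    have sq' : CommSq f' i' p g' := ⟨by ext <;> simp [f', i', g', h₂]⟩
    have e : sq'.lift.right = 𝟙 _ := by
      have := congr_arg Arrow.Hom.right sq'.fac_left
      exact (Category.id_comp _).symm.trans this
    refine ⟨⟨⟨sq'.lift.left, ?_, ?_⟩⟩⟩
    · exact congr_arg Arrow.Hom.left sq'.fac_left
    · apply pullback.hom_ext
      · simp only [Category.assoc, pullback.lift_fst]
        have := Arrow.w sq'.lift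
        rw [e] at this
        exact this.trans (Category.comp_id _)
      · simp only [Category.assoc, pullback.lift_snd]
        exact congr_arg Arrow.Hom.left sq'.fac_right

instance : (fibrations (Arrow C)).IsStableUnderRetracts := by
  rw [fibrations_arrow_eq_rlp]
  infer_instance

/-- The map into the pullback is factored, not `φ.left`. The middle object keeps the codomain of
`P`, so the first factor is vertical. -/
instance : (trivialCofibrations (Arrow C)).HasFactorization (fibrations (Arrow C)) where
  nonempty_mapFactorizationData {P Q} φ := by
    let d := MorphismProperty.factorizationData (trivialCofibrations C) (fibrations C)
      (pullback.lift P.hom φ.left (Arrow.w φ).symm : P.left ⟶ pullback φ.right Q.hom)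
    have h₁ := d.fac =≫ pullback.fst _ _
    have h₂ := d.fac =≫ pullback.snd _ _
    simp only [Category.assoc, pullback.lift_fst, pullback.lift_snd] at h₁ h₂
    exact ⟨{
      Z := Arrow.mk (d.p ≫ pullback.fst _ _)
      i := Arrow.homMk d.i (𝟙 _) (by simp [h₁])
      p := Arrow.homMk (d.p ≫ pullback.snd _ _) φ.right (by simp [pullback.condition])
      fac := by ext <;> simp [h₂]
      hi := ⟨⟨d.hi.1⟩, ⟨d.hi.2⟩, (inferInstance : IsIso (𝟙 P.right))⟩
      hp := by
        have h : pullback.lift (d.p ≫ pullback.fst _ _) (d.p ≫ pullback.snd φ.right Q.hom)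
            (by simp [pullback.condition]) = d.p := by
          apply pullback.hom_ext
          · rw [pullback.lift_fst]
          · rw [pullback.lift_snd]
        rw [← fibration_iff, arrow_fibration_iff]
        exact h.symm ▸ ⟨d.hp⟩ }⟩

instance : (cofibrations (Arrow C)).HasFactorization (trivialFibrations (Arrow C)) where
  nonempty_mapFactorizationData {P Q} φ := by
    let d := MorphismProperty.factorizationData (cofibrations C) (trivialFibrations C) φ.left
    let p : Arrow.mk (d.p ≫ Q.hom) ⟶ Q := Arrow.homMk d.p (𝟙 _) (by simp)
    have : IsIso p.right := (inferInstance : IsIso (𝟙 Q.right))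
    exact ⟨{
      Z := Arrow.mk (d.p ≫ Q.hom)
      i := Arrow.homMk d.i φ.right (by simp)
      p := p
      fac := by ext <;> simp [p]
      hi := ⟨d.hi⟩
      hp := ⟨((arrow_fibration_iff_of_isIso_right p).2 ⟨d.hp.1⟩).mem, ⟨d.hp.2⟩, this⟩ }⟩

scoped instance : ModelCategory (Arrow C) where

end HoFib.VerticalModelStructure

/-! ## Weak equivalences are the morphisms inverted by the localization -/

namespace HomotopicalAlgebra

variable {M : Type u₁} [Category.{v₁} M] [ModelCategory M] {H : Type u₂} [Category.{v₂} H]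
  (L : M ⥤ H) [L.IsLocalization (weakEquivalences M)]

lemma isIso_map_of_weakEquivalence {X Y : M} (w : X ⟶ Y) [WeakEquivalence w] : IsIso (L.map w) :=
  Localization.inverts L (weakEquivalences M) w ((weakEquivalence_iff w).1 inferInstance)

/-- A homotopy inverse `s` of `p` is deformed, by covering homotopy, to a strict section `s'`. Then
`p ≫ s'` is homotopic to the identity, hence a weak equivalence, and `p` is a retract of it. -/
lemma weakEquivalence_of_isIso_map_of_fibration {X Y : M} [IsCofibrant X] [IsFibrant X]
    [IsCofibrant Y] [IsFibrant Y] (p : X ⟶ Y) [Fibration p] [IsIso (L.map p)] :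
    WeakEquivalence p := by
  obtain ⟨s, hs⟩ := map_surjective_of_isLocalization L Y X (inv (L.map p))
  have h : LeftHomotopyRel (s ≫ p) (𝟙 Y) := by
    rw [LeftHomotopyRel.iff_map_eq L, L.map_comp, hs, IsIso.inv_hom_id, L.map_id]
  obtain ⟨P, _, ⟨h⟩⟩ := h.exists_good_cylinder
  obtain ⟨s', h', hh'⟩ := h.covering_homotopy p s rfl
  have hs' : s' ≫ p = 𝟙 Y := by rw [← h'.h₁, Category.assoc, hh', h.h₁]
  have hs'' : L.map s' = inv (L.map p) :=
    IsIso.eq_inv_of_inv_hom_id (by rw [← L.map_comp, hs', L.map_id])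
  have h : LeftHomotopyRel (p ≫ s') (𝟙 X) := by
    rw [LeftHomotopyRel.iff_map_eq L, L.map_comp, hs'', IsIso.hom_inv_id, L.map_id]
  obtain ⟨_, ⟨h⟩⟩ := h
  have hw : WeakEquivalence (p ≫ s') := h.weakEquivalence_iff.2 inferInstance
  have r : RetractArrow p (p ≫ s') :=
    { i := Arrow.homMk (𝟙 X) s' (by simp)
      r := Arrow.homMk (𝟙 X) p (by simp [hs'])
      retract := by
        ext
        · exact Category.comp_id _
        · exact hs' }
  rw [weakEquivalence_iff] at hw ⊢
  exact MorphismProperty.of_retract r hw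

lemma weakEquivalence_of_isIso_map_of_bifibrant {X Y : M} [IsCofibrant X] [IsFibrant X]
    [IsCofibrant Y] [IsFibrant Y] (f : X ⟶ Y) [IsIso (L.map f)] : WeakEquivalence f := by
  let d := MorphismProperty.factorizationData (trivialCofibrations M) (fibrations M) f
  have : IsCofibrant d.Z := isCofibrant_of_cofibration d.i
  have : IsFibrant d.Z := isFibrant_of_fibration d.p
  have := isIso_map_of_weakEquivalence L d.i
  have : IsIso (L.map d.i ≫ L.map d.p) := by rw [← L.map_comp, d.fac]; infer_instance
  have := IsIso.of_isIso_comp_left (L.map d.i) (L.map d.p)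
  have := weakEquivalence_of_isIso_map_of_fibration L d.p
  rw [← d.fac]
  infer_instance

lemma weakEquivalence_of_isIso_map {X Y : M} (f : X ⟶ Y) [IsIso (L.map f)] :
    WeakEquivalence f := by
  obtain ⟨X', _, a, _, _⟩ := CofibrantObject.HoCat.exists_resolution X
  obtain ⟨Y', _, b, _, _⟩ := CofibrantObject.HoCat.exists_resolution Y
  obtain ⟨X'', _, a', _, _⟩ := FibrantObject.HoCat.exists_resolution X'
  obtain ⟨Y'', _, b', _, _⟩ := FibrantObject.HoCat.exists_resolution Y'
  have : IsCofibrant X'' := isCofibrant_of_cofibration a'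
  have : IsCofibrant Y'' := isCofibrant_of_cofibration b'
  have sq : CommSq (initial.to Y') (initial.to X') b (a ≫ f) := ⟨Subsingleton.elim _ _⟩
  have sq' : CommSq (sq.lift ≫ b') a' (terminal.from Y'') (terminal.from X'') :=
    ⟨Subsingleton.elim _ _⟩
  have := isIso_map_of_weakEquivalence L a
  have := isIso_map_of_weakEquivalence L a'
  have := isIso_map_of_weakEquivalence L b
  have := isIso_map_of_weakEquivalence L b'
  have : IsIso (L.map sq.lift ≫ L.map b) := by
    rw [← L.map_comp, sq.fac_right, L.map_comp]
    infer_instance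
  have := IsIso.of_isIso_comp_right (L.map sq.lift) (L.map b)
  have : IsIso (L.map a' ≫ L.map sq'.lift) := by
    rw [← L.map_comp, sq'.fac_left, L.map_comp]
    infer_instance
  have := IsIso.of_isIso_comp_left (L.map a') (L.map sq'.lift)
  have := weakEquivalence_of_isIso_map_of_bifibrant L sq'.lift
  have : WeakEquivalence (sq.lift ≫ b') := by rw [← sq'.fac_left]; infer_instance
  have : WeakEquivalence sq.lift := weakEquivalence_of_postcomp _ b'
  have : WeakEquivalence (a ≫ f) := by rw [← sq.fac_right]; infer_instance
  exact weakEquivalence_of_precomp a f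

end HomotopicalAlgebra

/-! ### Morphisms of the homotopy category as homotopy classes -/

namespace HoFib

open VerticalModelStructure

variable {C : Type u} [Category.{v} C] [ModelCategory C]

/-- A pair `(w, e)` with `e` invertible is the vertical weak equivalence `(w, 𝟙)` followed by the
isomorphism `(𝟙, e)`. -/
lemma isInvertedBy_verticalWeakEquivalences_Q :
    (weakEquivalences (Arrow C)).IsInvertedBy (verticalWeakEquivalences C).Q := by
  intro P Q φ hφ
  have : WeakEquivalence φ := ⟨hφ⟩
  let v : P ⟶ Arrow.mk (Q.hom ≫ inv φ.right) := Arrow.homMk φ.left (𝟙 _) (by simp)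
  let e : Arrow.mk (Q.hom ≫ inv φ.right) ⟶ Q := Arrow.homMk (𝟙 _) φ.right (by simp)
  have hv : verticalWeakEquivalences C v :=
    ⟨IsHomLift.map (Arrow.rightFunc : Arrow C ⥤ C) v, (inferInstance : WeakEquivalence φ.left)⟩
  have : IsIso e.left := (inferInstance : IsIso (𝟙 Q.left))
  have : IsIso e.right := (inferInstance : IsIso φ.right)
  have : IsIso e := Arrow.isIso_of_isIso_left_of_isIso_right e
  have h : φ = v ≫ e := by
    ext
    · exact (Category.comp_id _).symm
    · exact (Category.id_comp _).symm
  have := Localization.inverts (verticalWeakEquivalences C).Q _ v hv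
  rw [h, Functor.map_comp]
  infer_instance

lemma verticalWeakEquivalences_le :
    verticalWeakEquivalences C ≤ weakEquivalences (Arrow C) := by
  intro P Q φ hφ
  refine ⟨hφ.2, ?_⟩
  have := verticalWeakEquivalences_isInvertedBy_rightFunc C φ hφ
  exact this

/-- This makes `HoArrow C` the homotopy category of a model category, so that its morphisms can be
computed by homotopies. -/
instance : (verticalWeakEquivalences C).Q.IsLocalization (weakEquivalences (Arrow C)) := by
  have : (𝟭 (HoArrow C)).IsLocalization ⊥ := .for_id _ bot_le
  have := Functor.IsLocalization.comp (verticalWeakEquivalences C).Q (𝟭 _)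
    (verticalWeakEquivalences C) ⊥ (weakEquivalences (Arrow C))
    isInvertedBy_verticalWeakEquivalences_Q verticalWeakEquivalences_le bot_le
  exact this

lemma hoFfb_map_gammaFb_map {P Q : FibArrow C} (φ : P ⟶ Q) :
    (hoFfb C).map ((gammaFb C).map φ) = (codFib C).map φ :=
  eq_of_heq (Functor.hcongr_hom (gammaFb_comp_hoFfb C) φ)

lemma exists_eq_gammaFb_obj (X : HoFibArrow C) : ∃ P : FibArrow C, X = (gammaFb C).obj P :=
  ⟨⟨_, X.property⟩, rfl⟩

instance (P : FibArrow C) : IsFibrant P.obj := isFibrant_arrow_iff.2 P.property.1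

instance (P : FibArrow C) : Fibration P.obj.hom := P.property.1

instance (P : FibArrow C) : IsFibrant P.obj.right := P.property.2

lemma isIso_gammaFb_map {P Q : FibArrow C} (φ : P ⟶ Q) [WeakEquivalence φ.hom] :
    IsIso ((gammaFb C).map φ) := by
  have : IsIso ((ObjectProperty.ι _).map ((gammaFb C).map φ)) :=
    Localization.inverts (verticalWeakEquivalences C).Q (weakEquivalences (Arrow C)) φ.hom
      ((weakEquivalence_iff _).1 inferInstance)
  exact isIso_of_reflects_iso _ (ObjectProperty.ι _)

lemma weakEquivalence_of_isIso_gammaFb_map {P Q : FibArrow C} (φ : P ⟶ Q)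
    [IsIso ((gammaFb C).map φ)] : WeakEquivalence φ.hom := by
  have : IsIso ((verticalWeakEquivalences C).Q.map φ.hom) :=
    (inferInstance : IsIso ((ObjectProperty.ι _).map ((gammaFb C).map φ)))
  exact weakEquivalence_of_isIso_map (verticalWeakEquivalences C).Q φ.hom

lemma exists_cofibrant_replacement (P : FibArrow C) :
    ∃ (P' : FibArrow C) (w : P' ⟶ P), IsCofibrant P'.obj ∧ WeakEquivalence w.hom := by
  obtain ⟨P', _, w, _, _⟩ := CofibrantObject.HoCat.exists_resolution P.obj
  have : Fibration P'.hom := isFibrant_arrow_iff.1 (isFibrant_of_fibration w)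
  have : IsFibrant P'.right := isFibrant_of_fibration w.right
  exact ⟨⟨P', ‹_›, ‹_›⟩, ObjectProperty.homMk w, ‹_›, ‹_›⟩

lemma gammaFb_map_surjective {P Q : FibArrow C} [IsCofibrant P.obj]
    (r : (gammaFb C).obj P ⟶ (gammaFb C).obj Q) : ∃ ρ : P ⟶ Q, (gammaFb C).map ρ = r := by
  obtain ⟨ρ, hρ⟩ := map_surjective_of_isLocalization (verticalWeakEquivalences C).Q P.obj Q.obj r.hom
  exact ⟨ObjectProperty.homMk ρ, ObjectProperty.hom_ext _ hρ⟩

lemma gammaFb_map_eq_iff {P Q : FibArrow C} [IsCofibrant P.obj] (ρ ρ' : P ⟶ Q) :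
    (gammaFb C).map ρ = (gammaFb C).map ρ' ↔ LeftHomotopyRel ρ.hom ρ'.hom := by
  rw [LeftHomotopyRel.iff_map_eq (verticalWeakEquivalences C).Q]
  exact ⟨fun h ↦ (ObjectProperty.ι _).congr_map h,
    fun h ↦ ObjectProperty.hom_ext _ h⟩

end HoFib

/-! ## Universal properties in the homotopy category -/

namespace HoFib

open VerticalModelStructure

variable {C : Type u} [Category.{v} C] [ModelCategory C]

/-- The codomain part of a morphism of the homotopy category. -/
noncomputable def base {P Q : FibArrow C} (χ : (gammaFb C).obj P ⟶ (gammaFb C).obj Q) :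
    P.obj.right ⟶ Q.obj.right :=
  ((hoFfb C).map χ).hom

@[simp]
lemma base_gammaFb_map {P Q : FibArrow C} (φ : P ⟶ Q) :
    base ((gammaFb C).map φ) = φ.hom.right :=
  (fibrantObjects C).ι.congr_map (hoFfb_map_gammaFb_map φ)

@[simp]
lemma base_comp {P Q R : FibArrow C} (χ : (gammaFb C).obj P ⟶ (gammaFb C).obj Q)
    (χ' : (gammaFb C).obj Q ⟶ (gammaFb C).obj R) : base (χ ≫ χ') = base χ ≫ base χ' :=
  (fibrantObjects C).ι.congr_map ((hoFfb C).map_comp χ χ')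

/-- The codomain part of a homotopy of arrows is constant. -/
lemma leftHomotopy_right {P Q : Arrow C} {Z : Cylinder P} {φ ψ : P ⟶ Q}
    (h : Z.LeftHomotopy φ ψ) : h.h.right = Z.π.right ≫ φ.right := by
  have h₁ : Z.i₀.right ≫ h.h.right = φ.right := congr_arg Arrow.Hom.right h.h₀
  have h₂ : Z.i₀.right ≫ Z.π.right = 𝟙 _ := congr_arg Arrow.Hom.right Z.i₀_π
  rw [← cancel_epi Z.i₀.right, h₁, reassoc_of% h₂]

/-- Since `S` is cofibrant and all fibrations are fibrant, every class has a representative. `H` at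
`S` gives existence, and `H` at a cylinder combines homotopies into the `Q i` into a homotopy into
`R`. -/
lemma existsUnique_family_cofibrant {ι : Type*} {R : FibArrow C} {Q : ι → FibArrow C}
    (φ : ∀ i, R ⟶ Q i)
    (H : ∀ (S : Arrow C) (g : S.right ⟶ R.obj.right) (r : ∀ i, S ⟶ (Q i).obj),
      (∀ i, (r i).right = g ≫ (φ i).hom.right) →
        ∃! χ : S ⟶ R.obj, χ.right = g ∧ ∀ i, χ ≫ (φ i).hom = r i)
    (S : FibArrow C) [IsCofibrant S.obj] (g : S.obj.right ⟶ R.obj.right)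
    (r : ∀ i, (gammaFb C).obj S ⟶ (gammaFb C).obj (Q i))
    (hr : ∀ i, base (r i) = g ≫ (φ i).hom.right) :
    ∃! χ : (gammaFb C).obj S ⟶ (gammaFb C).obj R,
      base χ = g ∧ ∀ i, χ ≫ (gammaFb C).map (φ i) = r i := by
  choose ρ hρ using fun i ↦ gammaFb_map_surjective (r i)
  have hρ' (i) : (ρ i).hom.right = g ≫ (φ i).hom.right := by
    rw [← hr, ← hρ, base_gammaFb_map]
  obtain ⟨χ, ⟨h₁, h₂⟩, -⟩ := H S.obj g (fun i ↦ (ρ i).hom) hρ'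
  refine ⟨(gammaFb C).map (ObjectProperty.homMk χ), ⟨?_, fun i ↦ ?_⟩, ?_⟩
  · rw [base_gammaFb_map]
    exact h₁
  · rw [← Functor.map_comp, ← hρ]
    congr 1
    exact ObjectProperty.hom_ext _ (h₂ i)
  · rintro s ⟨hs, hs'⟩
    obtain ⟨σ, rfl⟩ := gammaFb_map_surjective s
    rw [gammaFb_map_eq_iff]
    rw [base_gammaFb_map] at hs
    -- A single cylinder serves all `i`, so the homotopies `K i` form one family out of `Z.I`. Their
    -- codomain parts are constant, which is the compatibility that `H` requires.
    obtain ⟨Z, _⟩ := Cylinder.exists_very_good S.obj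
    have K (i) : Z.LeftHomotopy (σ ≫ φ i).hom (ρ i).hom := by
      refine LeftHomotopyRel.leftHomotopy ?_ Z
      rw [← gammaFb_map_eq_iff, Functor.map_comp, hs', hρ]
    obtain ⟨h, ⟨k₁, k₂⟩, -⟩ := H Z.I (Z.π.right ≫ σ.hom.right) (fun i ↦ (K i).h) (fun i ↦ by
      rw [leftHomotopy_right (K i), Category.assoc]
      rfl)
    have e₀ : Z.i₀.right ≫ Z.π.right = 𝟙 _ := congr_arg Arrow.Hom.right Z.i₀_π
    have e₁ : Z.i₁.right ≫ Z.π.right = 𝟙 _ := congr_arg Arrow.Hom.right Z.i₁_π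
    -- The two ends of `h` are identified by the uniqueness in `H`.
    refine Cylinder.LeftHomotopy.leftHomotopyRel (P := Z) ⟨h, ?_, ?_⟩
    · refine (H S.obj σ.hom.right (fun i ↦ (σ ≫ φ i).hom) (fun i ↦ rfl)).unique
        ⟨?_, fun i ↦ ?_⟩ ⟨rfl, fun i ↦ rfl⟩
      · rw [Arrow.comp_right, k₁, reassoc_of% e₀]
      · rw [Category.assoc, k₂, (K i).h₀]
    · refine (H S.obj g (fun i ↦ (ρ i).hom) hρ').unique ⟨?_, fun i ↦ ?_⟩ ⟨h₁, h₂⟩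
      · rw [Arrow.comp_right, k₁, reassoc_of% e₁, hs]
      · rw [Category.assoc, k₂, (K i).h₁]

/-- A family of morphisms of fibrations that is jointly cartesian in the arrow category remains so
in the homotopy category. -/
theorem existsUnique_family {ι : Type*} {R : FibArrow C} {Q : ι → FibArrow C}
    (φ : ∀ i, R ⟶ Q i)
    (H : ∀ (S : Arrow C) (g : S.right ⟶ R.obj.right) (r : ∀ i, S ⟶ (Q i).obj),
      (∀ i, (r i).right = g ≫ (φ i).hom.right) →
        ∃! χ : S ⟶ R.obj, χ.right = g ∧ ∀ i, χ ≫ (φ i).hom = r i)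
    (S : FibArrow C) (g : S.obj.right ⟶ R.obj.right)
    (r : ∀ i, (gammaFb C).obj S ⟶ (gammaFb C).obj (Q i))
    (hr : ∀ i, base (r i) = g ≫ (φ i).hom.right) :
    ∃! χ : (gammaFb C).obj S ⟶ (gammaFb C).obj R,
      base χ = g ∧ ∀ i, χ ≫ (gammaFb C).map (φ i) = r i := by
  obtain ⟨S', w, _, _⟩ := exists_cofibrant_replacement S
  have := isIso_gammaFb_map w
  obtain ⟨χ, ⟨h₁, h₂⟩, h₃⟩ := existsUnique_family_cofibrant φ H S' (w.hom.right ≫ g)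
    (fun i ↦ (gammaFb C).map w ≫ r i) (fun i ↦ by
      rw [base_comp, hr, base_gammaFb_map, Category.assoc])
  refine ⟨inv ((gammaFb C).map w) ≫ χ, ⟨?_, fun i ↦ ?_⟩, ?_⟩
  · rw [← cancel_epi w.hom.right, ← h₁, ← base_gammaFb_map, ← base_comp, IsIso.hom_inv_id_assoc]
  · rw [Category.assoc, h₂, IsIso.inv_hom_id_assoc]
  · rintro s ⟨hs, hs'⟩
    rw [IsIso.eq_inv_comp]
    refine h₃ _ ⟨?_, fun i ↦ ?_⟩
    · rw [base_comp, base_gammaFb_map, hs]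
    · rw [Category.assoc, hs']

/-! ### The cocartesian universal property -/

/-- The morphism from `⊥_ C ⟶ X` with a given codomain part. -/
noncomputable def homOfRight {X : C} {Q : Arrow C} (a : X ⟶ Q.right) :
    Arrow.mk (initial.to X) ⟶ Q :=
  Arrow.homMk (initial.to _) a (Subsingleton.elim (α := ⊥_ C ⟶ _) _ _)

lemma homOfRight_injective {X : C} {Q : Arrow C} {a b : X ⟶ Q.right}
    (h : homOfRight a = homOfRight b) : a = b :=
  congr_arg Arrow.Hom.right h

lemma homOfRight_comp {X : C} {Q R : Arrow C} (a : X ⟶ Q.right) (φ : Q ⟶ R) :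
    homOfRight a ≫ φ = homOfRight (a ≫ φ.right) := by
  ext
  · exact Subsingleton.elim (α := ⊥_ C ⟶ _) _ _
  · rfl

/-- Maps out of the arrow `⊥_ C ⟶ X` are the same as maps from `X` to the codomain, so joint
monicity of the projections passes to codomains without computing the product. -/
lemma right_comp_prod_hom_ext {P Q R : Arrow C} {a b : P.right ⟶ (Q ⨯ R).right}
    (h₁ : a ≫ (prod.fst : Q ⨯ R ⟶ Q).right = b ≫ (prod.fst : Q ⨯ R ⟶ Q).right)
    (h₂ : a ≫ (prod.snd : Q ⨯ R ⟶ R).right = b ≫ (prod.snd : Q ⨯ R ⟶ R).right) : a = b := by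
  refine homOfRight_injective (Limits.prod.hom_ext ?_ ?_)
  · rw [homOfRight_comp, homOfRight_comp, h₁]
  · rw [homOfRight_comp, homOfRight_comp, h₂]

lemma right_comp_terminal_hom_ext {P : Arrow C} (a b : P.right ⟶ (⊤_ (Arrow C)).right) : a = b :=
  homOfRight_injective (Subsingleton.elim _ _)

lemma rightHomotopy_right {P Q : Arrow C} {Z : PathObject Q} {φ ψ : P ⟶ Q}
    (h : Z.RightHomotopy φ ψ) : h.h.right = φ.right ≫ Z.ι.right := by
  have h₁ : h.h.right ≫ Z.p₀.right = φ.right := congr_arg Arrow.Hom.right h.h₀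
  have h₂ : Z.ι.right ≫ Z.p₀.right = 𝟙 _ := congr_arg Arrow.Hom.right Z.ι_p₀
  rw [← cancel_mono Z.p₀.right, h₁, Category.assoc, h₂, Category.comp_id]

/-- Existence is a lift against the fibrant object `R`, uniqueness a lift of a right homotopy
against a path object. As `φ.hom.right` is arbitrary, `φ` is no trivial cofibration of arrows; the
prescribed codomain part `g` makes up for this. -/
lemma existsUnique_of_trivialCofibration {P Q : FibArrow C} (φ : P ⟶ Q) [IsCofibrant P.obj]
    [IsCofibrant Q.obj] [Cofibration φ.hom.left] [WeakEquivalence φ.hom.left] (R : FibArrow C)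
    (g : Q.obj.right ⟶ R.obj.right) (r : (gammaFb C).obj P ⟶ (gammaFb C).obj R)
    (hr : base r = φ.hom.right ≫ g) :
    ∃! χ : (gammaFb C).obj Q ⟶ (gammaFb C).obj R, base χ = g ∧ (gammaFb C).map φ ≫ χ = r := by
  obtain ⟨ρ, rfl⟩ := gammaFb_map_surjective r
  rw [base_gammaFb_map] at hr
  have : Fibration (terminal.from R.obj) := inferInstanceAs (IsFibrant R.obj)
  obtain ⟨χ, h₁, h₂, -⟩ := exists_lift_of_right φ.hom (terminal.from R.obj) ρ.hom (terminal.from _)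
    (Subsingleton.elim _ _) g hr.symm (right_comp_terminal_hom_ext _ _)
  refine ⟨(gammaFb C).map (ObjectProperty.homMk χ), ⟨?_, ?_⟩, ?_⟩
  · rw [base_gammaFb_map]
    exact h₁
  · rw [← Functor.map_comp]
    congr 1
    exact ObjectProperty.hom_ext _ h₂
  · rintro s ⟨hs, hs'⟩
    obtain ⟨σ, rfl⟩ := gammaFb_map_surjective s
    rw [← Functor.map_comp, gammaFb_map_eq_iff, leftHomotopyRel_iff_rightHomotopyRel] at hs'
    rw [gammaFb_map_eq_iff, leftHomotopyRel_iff_rightHomotopyRel]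
    rw [base_gammaFb_map] at hs
    obtain ⟨Z, _, ⟨K⟩⟩ := hs'.exists_good_pathObject
    have hK := rightHomotopy_right K
    have e₀ : Z.ι.right ≫ Z.p₀.right = 𝟙 _ := congr_arg Arrow.Hom.right Z.ι_p₀
    have e₁ : Z.ι.right ≫ Z.p₁.right = 𝟙 _ := congr_arg Arrow.Hom.right Z.ι_p₁
    -- The homotopy `K` over `P` is extended to `Q` with ends `σ` and `χ`; its codomain part is the
    -- constant homotopy at `g`.
    obtain ⟨h, -, -, k⟩ := exists_lift_of_right φ.hom Z.p K.h (prod.lift σ.hom χ)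
      (by
        apply Limits.prod.hom_ext
        · simp only [Category.assoc, PrepathObject.p_fst, K.h₀, prod.lift_fst]
          rfl
        · simp only [Category.assoc, PrepathObject.p_snd, K.h₁, prod.lift_snd, h₂])
      (g ≫ Z.ι.right) (by rw [hK, ← hs]; exact (Category.assoc _ _ _).symm)
      (by
        apply right_comp_prod_hom_ext
        · rw [Category.assoc, Category.assoc, ← Arrow.comp_right, PrepathObject.p_fst, e₀,
            ← Arrow.comp_right, prod.lift_fst, hs, Category.comp_id]
        · rw [Category.assoc, Category.assoc, ← Arrow.comp_right, PrepathObject.p_snd, e₁,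
            ← Arrow.comp_right, prod.lift_snd, h₁, Category.comp_id])
    refine ⟨Z, ⟨⟨h, ?_, ?_⟩⟩⟩
    · rw [← PrepathObject.p_fst, ← Category.assoc, k, prod.lift_fst]
    · rw [← PrepathObject.p_snd, ← Category.assoc, k, prod.lift_snd]
      rfl

/-- Morphisms of fibrations whose domain part is a weak equivalence have the universal property of
cocartesian morphisms in the homotopy category. -/
theorem existsUnique_of_weakEquivalence {P Q : FibArrow C} (φ : P ⟶ Q)
    [WeakEquivalence φ.hom.left] (R : FibArrow C)
    (g : Q.obj.right ⟶ R.obj.right) (r : (gammaFb C).obj P ⟶ (gammaFb C).obj R)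
    (hr : base r = φ.hom.right ≫ g) :
    ∃! χ : (gammaFb C).obj Q ⟶ (gammaFb C).obj R, base χ = g ∧ (gammaFb C).map φ ≫ χ = r := by
  obtain ⟨P', w, _, _⟩ := exists_cofibrant_replacement P
  have := isIso_gammaFb_map w
  -- Up to the weak equivalences `w` and `v`, `φ` is replaced by `φ'`, whose domain part is a
  -- trivial cofibration. Here `d.p` is a weak equivalence by two-out-of-three.
  let d := MorphismProperty.factorizationData (trivialCofibrations C) (fibrations C)
    (w.hom.left ≫ φ.hom.left)
  let Q' : FibArrow C := ⟨Arrow.mk (d.p ≫ Q.obj.hom), (inferInstance : Fibration (d.p ≫ Q.obj.hom)),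
    Q.property.2⟩
  let φ' : P' ⟶ Q' := ObjectProperty.homMk (Arrow.homMk d.i (w.hom.right ≫ φ.hom.right) (by
    change d.i ≫ d.p ≫ Q.obj.hom = _
    rw [d.fac_assoc, Category.assoc, Arrow.w, Arrow.w_assoc]))
  let v : Q' ⟶ Q := ObjectProperty.homMk (Arrow.homMk d.p (𝟙 _) (Category.comp_id _).symm)
  have fac : φ' ≫ v = w ≫ φ := by
    refine ObjectProperty.hom_ext _ ?_
    ext
    · exact d.fac
    · exact Category.comp_id _
  have : Cofibration φ'.hom.left := inferInstanceAs (Cofibration d.i)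
  have : WeakEquivalence φ'.hom.left := inferInstanceAs (WeakEquivalence d.i)
  have : Cofibration φ'.hom := (arrow_cofibration_iff _).2 inferInstance
  have : IsCofibrant Q'.obj := isCofibrant_of_cofibration φ'.hom
  have : WeakEquivalence d.p := weakEquivalence_of_precomp_of_fac d.fac
  have : WeakEquivalence v.hom :=
    (arrow_weakEquivalence_iff _).2 ⟨this, inferInstanceAs (IsIso (𝟙 _))⟩
  have := isIso_gammaFb_map v
  have fac' : (gammaFb C).map φ' ≫ (gammaFb C).map v = (gammaFb C).map w ≫ (gammaFb C).map φ := by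
    rw [← Functor.map_comp, fac, Functor.map_comp]
  have hv : v.hom.right = 𝟙 _ := rfl
  obtain ⟨χ, ⟨h₁, h₂⟩, h₃⟩ := existsUnique_of_trivialCofibration φ' R g ((gammaFb C).map w ≫ r) (by
    rw [base_comp, hr, base_gammaFb_map]
    exact (Category.assoc _ _ _).symm)
  refine ⟨inv ((gammaFb C).map v) ≫ χ, ⟨?_, ?_⟩, ?_⟩
  · rw [← cancel_epi v.hom.right]
    rw [← base_gammaFb_map v, ← base_comp, IsIso.hom_inv_id_assoc, h₁, base_gammaFb_map]
    exact (Category.id_comp _).symm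
  · rw [← cancel_epi ((gammaFb C).map w), ← reassoc_of% fac', IsIso.hom_inv_id_assoc, h₂]
  · rintro s ⟨hs, hs'⟩
    rw [IsIso.eq_inv_comp]
    refine h₃ _ ⟨?_, ?_⟩
    · rw [base_comp, base_gammaFb_map, hs]
      exact Category.id_comp _
    · rw [reassoc_of% fac', hs']

end HoFib

/-! ## Pairs of morphisms with a joint cartesian universal property -/

namespace WedgeFib

variable {𝒮 : Type u₁} {𝒳 : Type u₂} [Category.{v₁} 𝒮] [Category.{v₂} 𝒳] (p : 𝒳 ⥤ 𝒮)

/-- Two morphisms `φ₁ : R ⟶ Q₁`, `φ₂ : R ⟶ Q₂` over `f₁ : A ⟶ B₁`, `f₂ : A ⟶ B₂` form a cartesian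
pair if morphisms to `R` over any `g` correspond to pairs of morphisms to `Q₁` and `Q₂` over `g ≫ f₁`
and `g ≫ f₂`. -/
structure IsCartesianPair {A B₁ B₂ : 𝒮} (f₁ : A ⟶ B₁) (f₂ : A ⟶ B₂) {R Q₁ Q₂ : 𝒳} (φ₁ : R ⟶ Q₁)
    (φ₂ : R ⟶ Q₂) : Prop where
  isHomLift₁ : p.IsHomLift f₁ φ₁
  isHomLift₂ : p.IsHomLift f₂ φ₂
  existsUnique {A' : 𝒮} {S : 𝒳} (g : A' ⟶ A) (r₁ : S ⟶ Q₁) (r₂ : S ⟶ Q₂) :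
    p.IsHomLift (g ≫ f₁) r₁ → p.IsHomLift (g ≫ f₂) r₂ →
      ∃! χ : S ⟶ R, p.IsHomLift g χ ∧ χ ≫ φ₁ = r₁ ∧ χ ≫ φ₂ = r₂

namespace IsCartesianPair

variable {p} {A B₁ B₂ : 𝒮} {f₁ : A ⟶ B₁} {f₂ : A ⟶ B₂} {R Q₁ Q₂ : 𝒳} {φ₁ : R ⟶ Q₁} {φ₂ : R ⟶ Q₂}

lemma hom_ext (h : IsCartesianPair p f₁ f₂ φ₁ φ₂) {A' : 𝒮} {S : 𝒳} (g : A' ⟶ A) {χ χ' : S ⟶ R}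
    [p.IsHomLift g χ] [p.IsHomLift g χ'] (h₁ : χ ≫ φ₁ = χ' ≫ φ₁) (h₂ : χ ≫ φ₂ = χ' ≫ φ₂) :
    χ = χ' := by
  have := h.isHomLift₁
  have := h.isHomLift₂
  exact (h.existsUnique g (χ' ≫ φ₁) (χ' ≫ φ₂) inferInstance inferInstance).unique
    ⟨inferInstance, h₁, h₂⟩ ⟨inferInstance, rfl, rfl⟩

lemma symm (h : IsCartesianPair p f₁ f₂ φ₁ φ₂) : IsCartesianPair p f₂ f₁ φ₂ φ₁ where
  isHomLift₁ := h.isHomLift₂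
  isHomLift₂ := h.isHomLift₁
  existsUnique g r₁ r₂ h₁ h₂ := by
    simpa only [and_comm (a := _ ≫ φ₁ = r₂)] using h.existsUnique g r₂ r₁ h₂ h₁

lemma comp_cartesian (h : IsCartesianPair p f₁ f₂ φ₁ φ₂) {B : 𝒮} {Q : 𝒳} (k : B₂ ⟶ B) (c : Q₂ ⟶ Q)
    [p.IsStronglyCartesian k c] : IsCartesianPair p f₁ (f₂ ≫ k) φ₁ (φ₂ ≫ c) where
  isHomLift₁ := h.isHomLift₁
  isHomLift₂ := by
    have := h.isHomLift₂
    infer_instance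
  existsUnique {A' S} g r₁ r₂ h₁ h₂ := by
    have h₂' : p.IsHomLift ((g ≫ f₂) ≫ k) r₂ := by rwa [Category.assoc]
    let r := Functor.IsStronglyCartesian.map p k c (g := g ≫ f₂) rfl r₂
    obtain ⟨χ, ⟨k₀, k₁, k₂⟩, -⟩ := h.existsUnique g r₁ r h₁ inferInstance
    refine ⟨χ, ⟨k₀, k₁, ?_⟩, ?_⟩
    · rw [← Category.assoc, k₂, Functor.IsStronglyCartesian.fac]
    · rintro χ' ⟨l₀, l₁, l₂⟩
      have := h.isHomLift₂
      refine h.hom_ext g (l₁.trans k₁.symm) ?_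
      rw [k₂]
      exact Functor.IsStronglyCartesian.map_uniq p k c rfl r₂ _ (by rwa [Category.assoc])

lemma comp_iso (h : IsCartesianPair p f₁ f₂ φ₁ φ₂) {Q : 𝒳} (c : Q₂ ⟶ Q) [IsIso c]
    [p.IsHomLift (𝟙 B₂) c] : IsCartesianPair p f₁ f₂ φ₁ (φ₂ ≫ c) := by
  simpa using h.comp_cartesian (𝟙 B₂) c

lemma of_iso (h : IsCartesianPair p f₁ f₂ φ₁ φ₂) {R' : 𝒳} (e : R' ≅ R)
    [p.IsHomLift (𝟙 A) e.hom] : IsCartesianPair p f₁ f₂ (e.hom ≫ φ₁) (e.hom ≫ φ₂) where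
  isHomLift₁ := by
    have := h.isHomLift₁
    infer_instance
  isHomLift₂ := by
    have := h.isHomLift₂
    infer_instance
  existsUnique {A' S} g r₁ r₂ h₁ h₂ := by
    obtain ⟨χ, ⟨k₀, k₁, k₂⟩, -⟩ := h.existsUnique g r₁ r₂ h₁ h₂
    refine ⟨χ ≫ e.inv, ⟨inferInstance, by simpa, by simpa⟩, ?_⟩
    rintro χ' ⟨l₀, l₁, l₂⟩
    rw [Iso.eq_comp_inv]
    exact h.hom_ext g (by simp [l₁, k₁]) (by simp [l₂, k₂])

/-- Cartesian pairs over the same morphisms are isomorphic. -/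
lemma exists_iso (h : IsCartesianPair p f₁ f₂ φ₁ φ₂) {R' : 𝒳} {φ₁' : R' ⟶ Q₁} {φ₂' : R' ⟶ Q₂}
    (h' : IsCartesianPair p f₁ f₂ φ₁' φ₂') :
    ∃ e : R' ≅ R, p.IsHomLift (𝟙 A) e.hom ∧ e.hom ≫ φ₁ = φ₁' ∧ e.hom ≫ φ₂ = φ₂' := by
  have := h.isHomLift₁
  have := h.isHomLift₂
  have := h'.isHomLift₁
  have := h'.isHomLift₂
  obtain ⟨u, ⟨u₀, u₁, u₂⟩, -⟩ := h.existsUnique (𝟙 A) φ₁' φ₂' inferInstance inferInstance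
  obtain ⟨v, ⟨v₀, v₁, v₂⟩, -⟩ := h'.existsUnique (𝟙 A) φ₁ φ₂ inferInstance inferInstance
  have := IsHomLift.id (p := p) (IsHomLift.domain_eq p f₁ φ₁)
  have := IsHomLift.id (p := p) (IsHomLift.domain_eq p f₁ φ₁')
  exact ⟨⟨u, v, h'.hom_ext (𝟙 A) (by simp [u₁, v₁]) (by simp [u₂, v₂]),
    h.hom_ext (𝟙 A) (by simp [u₁, v₁]) (by simp [u₂, v₂])⟩, u₀, u₁, u₂⟩

end IsCartesianPair

section Fiber

open Functor.Fiber

variable {p} {A : 𝒮}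

instance {P Q : p.Fiber A} (π : P ⟶ Q) : p.IsHomLift (𝟙 A) π.1 := π.2

variable {P Q R : p.Fiber A} {π₁ : R ⟶ P} {π₂ : R ⟶ Q}

lemma isLimit_of_existsUnique (H : ∀ {S : p.Fiber A} (r₁ : S.1 ⟶ P.1) (r₂ : S.1 ⟶ Q.1),
    p.IsHomLift (𝟙 A) r₁ → p.IsHomLift (𝟙 A) r₂ → ∃! χ : S.1 ⟶ R.1, p.IsHomLift (𝟙 A) χ ∧
      χ ≫ π₁.1 = r₁ ∧ χ ≫ π₂.1 = r₂) :
    Nonempty (IsLimit (BinaryFan.mk π₁ π₂)) := by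
  have H' (S : p.Fiber A) (r₁ : S ⟶ P) (r₂ : S ⟶ Q) := H r₁.1 r₂.1 r₁.2 r₂.2
  choose χ h₁ h₂ using H'
  exact ⟨BinaryFan.IsLimit.mk _ (fun r₁ r₂ ↦ ⟨χ _ r₁ r₂, (h₁ _ r₁ r₂).1⟩)
    (fun r₁ r₂ ↦ Subtype.ext (h₁ _ r₁ r₂).2.1) (fun r₁ r₂ ↦ Subtype.ext (h₁ _ r₁ r₂).2.2)
    (fun r₁ r₂ m hm₁ hm₂ ↦ Subtype.ext (h₂ _ r₁ r₂ m.1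
      ⟨m.2, congr_arg Subtype.val hm₁, congr_arg Subtype.val hm₂⟩))⟩

lemma IsCartesianPair.isLimit (h : IsCartesianPair p (𝟙 A) (𝟙 A) π₁.1
    π₂.1) : Nonempty (IsLimit (BinaryFan.mk π₁ π₂)) :=
  isLimit_of_existsUnique (fun r₁ r₂ h₁ h₂ ↦ h.existsUnique (𝟙 A) r₁ r₂ (by simpa) (by simpa))

/-- A product in the fiber tests only morphisms over `𝟙 A`. Comparison with one product known to be
a cartesian pair extends its universal property to morphisms over any `g`. -/
lemma IsCartesianPair.of_isLimit {R' : p.Fiber A} {π₁' : R' ⟶ P} {π₂' : R' ⟶ Q}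
    (h : IsCartesianPair p (𝟙 A) (𝟙 A) π₁'.1 π₂'.1)
    (hlim : Nonempty (IsLimit (BinaryFan.mk π₁ π₂))) :
    IsCartesianPair p (𝟙 A) (𝟙 A) π₁.1 π₂.1 := by
  obtain ⟨l⟩ := hlim
  obtain ⟨l'⟩ := h.isLimit
  let e : R ≅ R' := l.conePointUniqueUpToIso l'
  have e₁ : e.hom ≫ π₁' = π₁ := l.conePointUniqueUpToIso_hom_comp l' ⟨.left⟩
  have e₂ : e.hom ≫ π₂' = π₂ := l.conePointUniqueUpToIso_hom_comp l' ⟨.right⟩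
  let e' : R.1 ≅ R'.1 := ⟨e.hom.1, e.inv.1, congr_arg Subtype.val e.hom_inv_id,
    congr_arg Subtype.val e.inv_hom_id⟩
  have : p.IsHomLift (𝟙 A) e'.hom := e.hom.2
  rw [← e₁, ← e₂]
  exact h.of_iso e'

/-- If a product in the fiber over `B` is a cartesian pair, its pullback along `f : A ⟶ B` is a
product. -/
lemma IsCartesianPair.isLimit_pullback {B : 𝒮} (f : A ⟶ B) {P' Q' R' : p.Fiber B} {π₁' : R' ⟶ P'}
    {π₂' : R' ⟶ Q'}
    (h : IsCartesianPair p (𝟙 B) (𝟙 B) π₁'.1 π₂'.1)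
    (cP : P.1 ⟶ P'.1) (cQ : Q.1 ⟶ Q'.1) (cR : R.1 ⟶ R'.1) [p.IsStronglyCartesian f cP]
    [p.IsStronglyCartesian f cQ] [p.IsStronglyCartesian f cR]
    (comm₁ : π₁.1 ≫ cP = cR ≫ π₁'.1)
    (comm₂ : π₂.1 ≫ cQ = cR ≫ π₂'.1) :
    Nonempty (IsLimit (BinaryFan.mk π₁ π₂)) := by
  refine isLimit_of_existsUnique ?_
  intro S r₁ r₂ h₁ h₂
  obtain ⟨χ, ⟨k₀, k₁, k₂⟩, -⟩ := h.existsUnique f (r₁ ≫ cP) (r₂ ≫ cQ)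
    (by rw [Category.comp_id]; infer_instance) (by rw [Category.comp_id]; infer_instance)
  have hid : f = 𝟙 A ≫ f := (Category.id_comp f).symm
  refine ⟨Functor.IsStronglyCartesian.map p f cR hid χ, ⟨inferInstance, ?_, ?_⟩, ?_⟩
  · refine Functor.IsStronglyCartesian.ext p f cP (𝟙 A) ?_
    rw [Category.assoc, comm₁, Functor.IsStronglyCartesian.fac_assoc, k₁]
  · refine Functor.IsStronglyCartesian.ext p f cQ (𝟙 A) ?_
    rw [Category.assoc, comm₂, Functor.IsStronglyCartesian.fac_assoc, k₂]
  · rintro χ' ⟨l₀, l₁, l₂⟩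
    refine Functor.IsStronglyCartesian.map_uniq p f cR hid χ _ (h.hom_ext f ?_ ?_)
    · rw [Category.assoc, ← comm₁, reassoc_of% l₁, k₁]
    · rw [Category.assoc, ← comm₂, reassoc_of% l₂, k₂]

end Fiber

variable {p}

lemma isStronglyCocartesian_iso_comp_iso {A B : 𝒮} (f : A ⟶ B) {P P' Q Q' : 𝒳} (e : P' ≅ P)
    (φ : P ⟶ Q) (e' : Q ≅ Q') [p.IsHomLift (𝟙 A) e.hom] [p.IsStronglyCocartesian f φ]
    [p.IsHomLift (𝟙 B) e'.hom] : p.IsStronglyCocartesian f (e.hom ≫ φ ≫ e'.hom) := by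
  simpa using (inferInstance : p.IsStronglyCocartesian (𝟙 A ≫ f ≫ 𝟙 B) (e.hom ≫ φ ≫ e'.hom))

lemma exists_iso_of_isStronglyCocartesian {A B : 𝒮} (f : A ⟶ B) {P Q Q' : 𝒳} (φ : P ⟶ Q)
    (φ' : P ⟶ Q') [p.IsStronglyCocartesian f φ] [p.IsStronglyCocartesian f φ'] :
    ∃ e : Q ≅ Q', p.IsHomLift (𝟙 B) e.hom ∧ φ ≫ e.hom = φ' :=
  ⟨Functor.IsCocartesian.codomainUniqueUpToIso p f φ φ',
    Functor.IsCocartesian.map_isHomLift p f φ φ', Functor.IsCocartesian.fac p f φ φ'⟩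

lemma exists_iso_of_isStronglyCartesian {A B : 𝒮} (f : A ⟶ B) {P P' Q : 𝒳} (φ : P ⟶ Q)
    (φ' : P' ⟶ Q) [p.IsStronglyCartesian f φ] [p.IsStronglyCartesian f φ'] :
    ∃ e : P' ≅ P, p.IsHomLift (𝟙 A) e.hom ∧ e.hom ≫ φ = φ' :=
  ⟨Functor.IsCartesian.domainUniqueUpToIso p f φ φ',
    Functor.IsCartesian.map_isHomLift p f φ φ', Functor.IsCartesian.fac p f φ φ'⟩

end WedgeFib

/-! ## Cartesian and cocartesian morphisms of the homotopy category -/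

namespace HoFib

open WedgeFib

variable {C : Type u} [Category.{v} C] [ModelCategory C]

lemma isHomLift_hoFfb_iff {P Q : FibArrow C} (f : (codFib C).obj P ⟶ (codFib C).obj Q)
    (χ : (gammaFb C).obj P ⟶ (gammaFb C).obj Q) :
    (hoFfb C).IsHomLift f χ ↔ base χ = f.hom := by
  constructor
  · intro h
    exact congr_arg InducedCategory.Hom.hom (@IsHomLift.eq_of_isHomLift _ _ _ _ (hoFfb C)
      ((gammaFb C).obj P) ((gammaFb C).obj Q) f χ h).symm
  · intro h
    obtain rfl : f = (hoFfb C).map χ := ObjectProperty.hom_ext _ h.symm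
    exact IsHomLift.map (hoFfb C) χ

/-- A fibration over a fibrant object, as an object of `FibArrow C`. -/
def fibArrow {A : FibrantObject C} {X : C} (x : X ⟶ A.obj) [Fibration x] : FibArrow C :=
  ⟨Arrow.mk x, ‹_›, A.property⟩

/-- A fibration over `A`, as an object of the fiber over `A`. -/
noncomputable def fiberMk {A : FibrantObject C} {X : C} (x : X ⟶ A.obj) [Fibration x] :
    (hoFfb C).Fiber A :=
  ⟨(gammaFb C).obj (fibArrow x), rfl⟩

lemma exists_eq_fiberMk {A : FibrantObject C} (P : (hoFfb C).Fiber A) :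
    ∃ (X : C) (x : X ⟶ A.obj) (_ : Fibration x), P = fiberMk x := by
  obtain ⟨P, rfl⟩ := P
  obtain ⟨P, rfl⟩ := exists_eq_gammaFb_obj P
  exact ⟨_, P.obj.hom, P.property.1, rfl⟩

section

variable {A B : FibrantObject C} {X Y : C} {x : X ⟶ A.obj} {y : Y ⟶ B.obj} [Fibration x]
  [Fibration y] (f : A ⟶ B) (t : X ⟶ Y) (w : t ≫ y = x ≫ f.hom)

/-- The morphism of fibrations given by a commutative square. -/
def fibArrowHom : fibArrow x ⟶ fibArrow y :=
  ObjectProperty.homMk (Arrow.homMk t f.hom w)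

/-- The class in the homotopy category of a commutative square. -/
noncomputable def squareHom : (fiberMk x).1 ⟶ (fiberMk y).1 :=
  (gammaFb C).map (fibArrowHom f t w)

instance : (hoFfb C).IsHomLift f (squareHom f t w) :=
  (isHomLift_hoFfb_iff (P := fibArrow x) (Q := fibArrow y) f _).2 (base_gammaFb_map _)

lemma isStronglyCocartesian_squareHom [WeakEquivalence t] :
    (hoFfb C).IsStronglyCocartesian f (squareHom f t w) where
  universal_property' {R} g r hr := by
    obtain ⟨R, rfl⟩ := exists_eq_gammaFb_obj R
    have : WeakEquivalence (fibArrowHom f t w).hom.left := inferInstanceAs (WeakEquivalence t)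
    have h := (isHomLift_hoFfb_iff (P := fibArrow x) (Q := R) (f ≫ g) r).1 hr
    have := existsUnique_of_weakEquivalence (fibArrowHom f t w) R g.hom r h
    exact (existsUnique_congr fun χ ↦ and_congr
      (isHomLift_hoFfb_iff (P := fibArrow y) (Q := R) g χ).symm Iff.rfl).1 this

end

lemma isCartesianPair_squareHom {A B₁ B₂ : FibrantObject C} {X Y₁ Y₂ : C} {x : X ⟶ A.obj}
    {y₁ : Y₁ ⟶ B₁.obj} {y₂ : Y₂ ⟶ B₂.obj} [Fibration x] [Fibration y₁] [Fibration y₂]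
    (f₁ : A ⟶ B₁) (t₁ : X ⟶ Y₁) (w₁ : t₁ ≫ y₁ = x ≫ f₁.hom)
    (f₂ : A ⟶ B₂) (t₂ : X ⟶ Y₂) (w₂ : t₂ ≫ y₂ = x ≫ f₂.hom)
    (H : ∀ {Z : C} (a : Z ⟶ A.obj) (u₁ : Z ⟶ Y₁) (u₂ : Z ⟶ Y₂), u₁ ≫ y₁ = a ≫ f₁.hom →
      u₂ ≫ y₂ = a ≫ f₂.hom → ∃! u : Z ⟶ X, u ≫ x = a ∧ u ≫ t₁ = u₁ ∧ u ≫ t₂ = u₂) :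
    IsCartesianPair (hoFfb C) f₁ f₂ (squareHom f₁ t₁ w₁) (squareHom f₂ t₂ w₂) where
  isHomLift₁ := inferInstance
  isHomLift₂ := inferInstance
  existsUnique {A' S} g r₁ r₂ h₁ h₂ := by
    obtain rfl := IsHomLift.domain_eq (hoFfb C) (g ≫ f₁) r₁
    obtain ⟨S, rfl⟩ := exists_eq_gammaFb_obj S
    replace h₁ := (isHomLift_hoFfb_iff (P := S) (Q := fibArrow y₁) (g ≫ f₁) r₁).1 h₁
    replace h₂ := (isHomLift_hoFfb_iff (P := S) (Q := fibArrow y₂) (g ≫ f₂) r₂).1 h₂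
    let Q : Bool → FibArrow C := fun | true => fibArrow y₁ | false => fibArrow y₂
    let φ : ∀ b, fibArrow x ⟶ Q b :=
      fun | true => fibArrowHom f₁ t₁ w₁ | false => fibArrowHom f₂ t₂ w₂
    let r : ∀ b, (gammaFb C).obj S ⟶ (gammaFb C).obj (Q b) := fun | true => r₁ | false => r₂
    have := existsUnique_family φ (fun Z a s hs ↦ by
      obtain ⟨u, ⟨hu, hu₁, hu₂⟩, huniq⟩ := H (Z.hom ≫ a) (s true).left (s false).left
        (((Arrow.w (s true)).trans (congr_arg (Z.hom ≫ ·) (hs true))).trans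
          (Category.assoc _ _ _).symm)
        (((Arrow.w (s false)).trans (congr_arg (Z.hom ≫ ·) (hs false))).trans
          (Category.assoc _ _ _).symm)
      refine ⟨Arrow.homMk u a hu, ⟨rfl, Bool.forall_bool.2 ⟨?_, ?_⟩⟩, ?_⟩
      · ext
        · exact hu₂
        · exact (hs false).symm
      · ext
        · exact hu₁
        · exact (hs true).symm
      · rintro χ ⟨rfl, hχ⟩
        ext
        · exact huniq _ ⟨Arrow.w χ, congr_arg Arrow.Hom.left (hχ true),
            congr_arg Arrow.Hom.left (hχ false)⟩
        · rfl) S g.hom r (Bool.rec h₂ h₁)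
    exact (existsUnique_congr fun χ ↦ and_congr
      (isHomLift_hoFfb_iff (P := S) (Q := fibArrow x) g χ).symm
      (Bool.forall_bool.trans and_comm)).1 this

lemma isStronglyCartesian_squareHom {A B : FibrantObject C} {X Y : C} {x : X ⟶ A.obj}
    {y : Y ⟶ B.obj} [Fibration x] [Fibration y] (f : A ⟶ B) (t : X ⟶ Y)
    (h : IsPullback t x y f.hom) : (hoFfb C).IsStronglyCartesian f (squareHom f t h.w) where
  universal_property' {S} g r hr := by
    obtain ⟨S, rfl⟩ := exists_eq_gammaFb_obj S
    have hr' := (isHomLift_hoFfb_iff (P := S) (Q := fibArrow y) (g ≫ f) r).1 hr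
    have := existsUnique_family (ι := Unit) (fun _ ↦ fibArrowHom f t h.w) (fun Z a s hs ↦ by
      have w : (s ()).left ≫ y = (Z.hom ≫ a) ≫ f.hom :=
        ((Arrow.w (s ())).trans (congr_arg (Z.hom ≫ ·) (hs ()))).trans (Category.assoc _ _ _).symm
      refine ⟨Arrow.homMk (h.lift _ _ w) a (h.lift_snd _ _ w), ⟨rfl, fun _ ↦ ?_⟩, ?_⟩
      · ext
        · exact h.lift_fst _ _ w
        · exact (hs ()).symm
      · rintro χ ⟨rfl, hχ⟩
        ext
        · exact h.hom_ext ((congr_arg Arrow.Hom.left (hχ ())).trans (h.lift_fst _ _ w).symm)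
            ((Arrow.w χ).trans (h.lift_snd _ _ w).symm)
        · rfl) S g.hom (fun _ ↦ r) (fun _ ↦ hr')
    exact (existsUnique_congr fun χ ↦ and_congr
      (isHomLift_hoFfb_iff (P := S) (Q := fibArrow x) g χ).symm
      ⟨fun h ↦ h (), fun h _ ↦ h⟩).1 this

/-- The empty case of `existsUnique_family`: a square into an isomorphism is determined by its
codomain part. Allowing any `g` makes terminal objects stable under pullback. -/
lemma existsUnique_of_isIso {A : FibrantObject C} {X : C} (x : X ⟶ A.obj) [Fibration x] [IsIso x]
    {A' : FibrantObject C} (S : HoFibArrow C) (hS : (hoFfb C).obj S = A') (g : A' ⟶ A) :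
    ∃! χ : S ⟶ (fiberMk x).1, (hoFfb C).IsHomLift g χ := by
  obtain ⟨k, hk, hk'⟩ : ∃ k : A.obj ⟶ X, x ≫ k = 𝟙 X ∧ k ≫ x = 𝟙 A.obj :=
    ⟨inv x, IsIso.hom_inv_id x, IsIso.inv_hom_id x⟩
  obtain rfl := hS
  obtain ⟨S, rfl⟩ := exists_eq_gammaFb_obj S
  have := existsUnique_family (ι := PEmpty.{1}) (R := fibArrow x) (Q := fun i ↦ i.elim)
    (fun i ↦ i.elim) (fun Z a s hs ↦ by
      change Z.right ⟶ A.obj at a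
      have w : ((Z.hom ≫ a) ≫ k) ≫ x = Z.hom ≫ a := by rw [Category.assoc, hk', Category.comp_id]
      refine ⟨Arrow.homMk ((Z.hom ≫ a) ≫ k) a w, ⟨rfl, fun i ↦ i.elim⟩, ?_⟩
      rintro χ ⟨rfl, -⟩
      ext
      · have h : χ.left ≫ x = Z.hom ≫ χ.right := Arrow.w χ
        refine Eq.trans ?_ (congr_arg (· ≫ k) h)
        exact ((Category.comp_id _).symm.trans (congr_arg (χ.left ≫ ·) hk.symm)).trans
          (Category.assoc _ _ _).symm
      · rfl) S g.hom (fun i ↦ i.elim) (fun i ↦ i.elim)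
  exact (existsUnique_congr fun χ ↦ (and_iff_left fun i ↦ i.elim).trans
    (isHomLift_hoFfb_iff (P := S) (Q := fibArrow x) g χ).symm).1 this

end HoFib

/-! ## The base category -/

namespace HoFib

open WedgeFib

section Base

variable {C : Type u} [Category.{v} C] [ModelCategory C]

instance (X Y : C) [IsFibrant X] : Fibration (prod.snd : X ⨯ Y ⟶ Y) := by
  have h : IsPullback (prod.snd : X ⨯ Y ⟶ Y) prod.fst (terminal.from Y) (terminal.from X) :=
    (IsPullback.of_hasBinaryProduct' X Y).flip
  have : Fibration (terminal.from X) := (isFibrant_iff X).1 inferInstance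
  rw [fibration_iff]
  exact MorphismProperty.of_isPullback h.flip ((fibration_iff _).1 this)

instance (X Y : C) [IsFibrant X] [IsFibrant Y] : IsFibrant (X ⨯ Y) :=
  isFibrant_of_fibration (prod.snd : X ⨯ Y ⟶ Y)

/-- The product of fibrant objects is a product in the category of fibrant objects. -/
noncomputable def isLimitFibrantProd (X Y : FibrantObject C) :
    IsLimit (BinaryFan.mk (P := FibrantObject.mk (X.obj ⨯ Y.obj)) (ObjectProperty.homMk prod.fst)
      (ObjectProperty.homMk prod.snd) : BinaryFan X Y) :=
  BinaryFan.IsLimit.mk _ (fun f g ↦ ObjectProperty.homMk (prod.lift f.hom g.hom))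
    (fun f g ↦ ObjectProperty.hom_ext _ (prod.lift_fst f.hom g.hom))
    (fun f g ↦ ObjectProperty.hom_ext _ (prod.lift_snd f.hom g.hom))
    (fun f g _ h₁ h₂ ↦ ObjectProperty.hom_ext _ (prod.hom_ext
      ((congr_arg InducedCategory.Hom.hom h₁).trans (prod.lift_fst f.hom g.hom).symm)
      ((congr_arg InducedCategory.Hom.hom h₂).trans (prod.lift_snd f.hom g.hom).symm)))

instance : HasBinaryProducts (FibrantObject C) :=
  have (X Y : FibrantObject C) : HasLimit (pair X Y) := ⟨_, isLimitFibrantProd X Y⟩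
  hasBinaryProducts_of_hasLimit_pair _

instance : IsFibrant (⊤_ C) :=
  (isFibrant_iff_of_isTerminal (𝟙 (⊤_ C)) terminalIsTerminal).2 inferInstance

instance : HasTerminal (FibrantObject C) :=
  (IsTerminal.ofUniqueHom (Y := FibrantObject.mk (⊤_ C))
    (fun X ↦ ObjectProperty.homMk (terminal.from X.obj))
    (fun _ _ ↦ ObjectProperty.hom_ext _ (terminal.hom_ext _ _))).hasTerminal

/-- Up to isomorphism, `k` is the projection `X ⨯ D ⟶ D`, the pullback of the fibration from `X` to
the terminal object. -/
lemma fibration_of_isProductProjection {B D : FibrantObject C} {k : B ⟶ D}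
    (hk : IsProductProjection k) : Fibration k.hom := by
  obtain ⟨X, π₁, ⟨h⟩⟩ := hk
  let e := h.conePointUniqueUpToIso (isLimitFibrantProd X D)
  have he : e.hom.hom ≫ prod.snd = k.hom := congr_arg InducedCategory.Hom.hom
    (h.conePointUniqueUpToIso_hom_comp (isLimitFibrantProd X D) ⟨.right⟩)
  have : IsIso e.hom.hom := inferInstanceAs (IsIso ((fibrantObjects C).ι.map e.hom))
  rw [← he]
  exact inferInstanceAs (Fibration (e.hom.hom ≫ (prod.snd : X.obj ⨯ D.obj ⟶ D.obj)))

/-- The pullback in `C` of a fibration between fibrant objects is again fibrant, so it is also the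
pullback in the full subcategory. -/
lemma isPullback_hom_of_fibration {A B D E : FibrantObject C} {f : A ⟶ B} {h : A ⟶ D} {k : B ⟶ E}
    {g : D ⟶ E} (sq : IsPullback f h k g) [Fibration k.hom] :
    IsPullback f.hom h.hom k.hom g.hom := by
  have : IsFibrant (pullback k.hom g.hom) := isFibrant_of_fibration (pullback.snd k.hom g.hom)
  have sq' : IsPullback (P := FibrantObject.mk (pullback k.hom g.hom))
      (ObjectProperty.homMk (pullback.fst k.hom g.hom))
      (ObjectProperty.homMk (pullback.snd k.hom g.hom)) k g :=
    .of_map (fibrantObjects C).ι (ObjectProperty.hom_ext _ pullback.condition)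
      (IsPullback.of_hasPullback k.hom g.hom)
  exact (IsPullback.of_hasPullback k.hom g.hom).of_iso
    ((fibrantObjects C).ι.mapIso (sq'.isoIsPullback _ _ sq)) (Iso.refl _) (Iso.refl _) (Iso.refl _)
    ((Category.comp_id _).trans
      (congr_arg InducedCategory.Hom.hom (sq'.isoIsPullback_hom_fst _ _ sq)).symm)
    ((Category.comp_id _).trans
      (congr_arg InducedCategory.Hom.hom (sq'.isoIsPullback_hom_snd _ _ sq)).symm)
    (by simp) (by simp)

end Base

/-! ## Cocartesian morphisms -/

variable {C : Type u} [Category.{v} C] [ModelCategory C]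

lemma exists_trivialCofibration_fibration {X Y : C} (f : X ⟶ Y) :
    ∃ (Z : C) (i : X ⟶ Z) (p : Z ⟶ Y), WeakEquivalence i ∧ Cofibration i ∧ Fibration p ∧
      i ≫ p = f :=
  have d := MorphismProperty.factorizationData (trivialCofibrations C) (fibrations C) f
  ⟨d.Z, d.i, d.p, inferInstance, inferInstance, inferInstance, d.fac⟩

instance (P : FibArrow C) : Fibration (Y := ((codFib C).obj P).obj) P.obj.hom := P.property.1

lemma exists_lift_of_trivialCofibration {A B X Y : C} (i : A ⟶ B) (p : X ⟶ Y) [WeakEquivalence i]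
    [Cofibration i] [Fibration p] (f : A ⟶ X) (g : B ⟶ Y) (w : f ≫ p = i ≫ g) :
    ∃ l : B ⟶ X, i ≫ l = f ∧ l ≫ p = g :=
  have sq : CommSq f i p g := ⟨w⟩
  ⟨sq.lift, sq.fac_left, sq.fac_right⟩

lemma exists_cocartesian_lift (P : FibArrow C) {B : FibrantObject C} (f : (codFib C).obj P ⟶ B) :
    ∃ (Q : FibArrow C) (φ : P ⟶ Q), (codFib C).IsHomLift f φ ∧ WeakEquivalence φ.hom.left ∧
      (hoFfb C).IsStronglyCocartesian f ((gammaFb C).map φ) := by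
  obtain ⟨Y, t, y, ht, -, hy, w⟩ := exists_trivialCofibration_fibration (P.obj.hom ≫ f.hom)
  exact ⟨fibArrow y, fibArrowHom (A := (codFib C).obj P) (x := P.obj.hom) f t w,
    IsHomLift.map (codFib C) (fibArrowHom (A := (codFib C).obj P) (x := P.obj.hom) f t w), ht,
    isStronglyCocartesian_squareHom (A := (codFib C).obj P) (x := P.obj.hom) f t w⟩

open VerticalModelStructure in
theorem isStronglyCocartesian_gammaFb_map_iff {P Q : FibArrow C} (φ : P ⟶ Q) :
    (hoFfb C).IsStronglyCocartesian ((codFib C).map φ) ((gammaFb C).map φ) ↔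
      WeakEquivalence φ.hom.left := by
  let f := (codFib C).map φ
  constructor
  · intro h
    obtain ⟨Y, t, y, ht, ht', hy, w⟩ :=
      exists_trivialCofibration_fibration (Y := ((codFib C).obj Q).obj) (P.obj.hom ≫ φ.hom.right)
    let φ₀ : P ⟶ fibArrow (A := (codFib C).obj Q) y :=
      fibArrowHom (A := (codFib C).obj P) (x := P.obj.hom) f t w
    -- Lifting represents the comparison between the two cocartesian morphisms by an actual map `l`.
    -- Its class is invertible, which forces `l` to be a weak equivalence.
    obtain ⟨l, hl, hl'⟩ : ∃ l : Y ⟶ Q.obj.left, t ≫ l = φ.hom.left ∧ l ≫ Q.obj.hom = y :=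
      exists_lift_of_trivialCofibration (Y := ((codFib C).obj Q).obj) t Q.obj.hom φ.hom.left y
        ((Arrow.w φ.hom).trans w.symm)
    let χ : fibArrow (A := (codFib C).obj Q) y ⟶ Q :=
      ObjectProperty.homMk (Arrow.homMk l (𝟙 _) (hl'.trans (Category.comp_id _).symm))
    have hχ : φ₀ ≫ χ = φ := by
      refine ObjectProperty.hom_ext _ (Arrow.hom_ext _ _ hl (Category.comp_id _))
    have h₀ : (hoFfb C).IsStronglyCocartesian f ((gammaFb C).map φ₀) :=
      isStronglyCocartesian_squareHom (A := (codFib C).obj P) (x := P.obj.hom) f t w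
    have h₁ : (hoFfb C).IsStronglyCocartesian (f ≫ 𝟙 _) ((gammaFb C).map φ₀ ≫ (gammaFb C).map χ) := by
      rwa [← Functor.map_comp, hχ, Category.comp_id]
    have h₂ : (hoFfb C).IsHomLift (𝟙 ((codFib C).obj Q)) ((gammaFb C).map χ) :=
      
      (isHomLift_hoFfb_iff (P := fibArrow (A := (codFib C).obj Q) y) (Q := Q)
        (𝟙 ((codFib C).obj Q)) _).2 (base_gammaFb_map χ)
    have h₃ := Functor.IsStronglyCocartesian.of_comp (hoFfb C) (g := 𝟙 ((codFib C).obj Q)) (f := f)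
      (φ := (gammaFb C).map φ₀) (ψ := (gammaFb C).map χ)
    have := Functor.IsStronglyCocartesian.isIso_of_base_isIso (hoFfb C) (𝟙 ((codFib C).obj Q))
      ((gammaFb C).map χ)
    have := weakEquivalence_of_isIso_gammaFb_map χ
    have h₄ : WeakEquivalence l := inferInstanceAs (WeakEquivalence χ.hom.left)
    rw [← hl]
    infer_instance
  · intro h
    exact isStronglyCocartesian_squareHom (A := (codFib C).obj P) (B := (codFib C).obj Q)
      (x := P.obj.hom) (y := Q.obj.hom) f φ.hom.left (Arrow.w φ.hom)

end HoFib

/-! ## Finite products in the fibers -/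

namespace HoFib

open WedgeFib

variable {C : Type u} [Category.{v} C] [ModelCategory C]

lemma squareHom_comp_eq {A B D : FibrantObject C} {X Y Z : C} {x : X ⟶ A.obj} {y : Y ⟶ B.obj}
    {z : Z ⟶ D.obj} [Fibration x] [Fibration y] [Fibration z] {f : A ⟶ B} {t : X ⟶ Y}
    {w : t ≫ y = x ≫ f.hom} {g : B ⟶ D} {t' : Y ⟶ Z} {w' : t' ≫ z = y ≫ g.hom} {h : A ⟶ D}
    {s : X ⟶ Z} {w'' : s ≫ z = x ≫ h.hom} (ht : t ≫ t' = s) (hf : f ≫ g = h) :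
    squareHom f t w ≫ squareHom g t' w' = squareHom h s w'' := by
  subst ht hf
  exact ((gammaFb C).map_comp _ _).symm

lemma exists_cartesian_lift {A B : FibrantObject C} (f : A ⟶ B) (P : (hoFfb C).Fiber B) :
    ∃ (P' : HoFibArrow C) (c : P' ⟶ P.1), (hoFfb C).IsStronglyCartesian f c := by
  obtain ⟨X, x, _, rfl⟩ := exists_eq_fiberMk P
  exact ⟨_, _, isStronglyCartesian_squareHom f _ (IsPullback.of_hasPullback x f.hom)⟩

instance : (hoFfb C).IsFibered :=
  .of_exists_isStronglyCartesian (fun P _ f ↦ exists_cartesian_lift f ⟨P, rfl⟩)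

noncomputable def isTerminalFiberMkId (A : FibrantObject C) : IsTerminal (fiberMk (𝟙 A.obj)) :=
  have H (P : (hoFfb C).Fiber A) := existsUnique_of_isIso (𝟙 A.obj) P.1 P.2 (𝟙 A)
  IsTerminal.ofUniqueHom (fun P ↦ ⟨(H P).choose, (H P).choose_spec.1⟩)
    (fun P m ↦ Subtype.ext ((H P).choose_spec.2 _ m.2))

lemma existsUnique_of_isTerminal {A' A : FibrantObject C} {T : (hoFfb C).Fiber A}
    (hT : IsTerminal T) (g : A' ⟶ A) (S : (hoFfb C).Fiber A') :
    ∃! χ : S.1 ⟶ T.1, (hoFfb C).IsHomLift g χ := by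
  obtain ⟨χ, hχ, h⟩ := existsUnique_of_isIso (𝟙 A.obj) S.1 S.2 g
  let e := (isTerminalFiberMkId A).uniqueUpToIso hT
  refine ⟨χ ≫ e.hom.1, by simpa using (inferInstance : (hoFfb C).IsHomLift (g ≫ 𝟙 A) (χ ≫ e.hom.1)),
    fun χ' hχ' ↦ ?_⟩
  have h' := h (χ' ≫ e.inv.1)
    (by simpa using (inferInstance : (hoFfb C).IsHomLift (g ≫ 𝟙 A) (χ' ≫ e.inv.1)))
  have he : e.inv.1 ≫ e.hom.1 = 𝟙 T.1 := congr_arg Subtype.val e.inv_hom_id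
  rw [← h', Category.assoc, he, Category.comp_id]

lemma isTerminal_of_isStronglyCartesian {A B : FibrantObject C} (f : A ⟶ B)
    {T' : (hoFfb C).Fiber A} {T : (hoFfb C).Fiber B} (c : T'.1 ⟶ T.1)
    [(hoFfb C).IsStronglyCartesian f c] (hT : IsTerminal T) : Nonempty (IsTerminal T') := by
  have H (S : (hoFfb C).Fiber A) : ∃! χ : S ⟶ T', True := by
    obtain ⟨χ, hχ, h⟩ := existsUnique_of_isTerminal hT f S
    refine ⟨⟨Functor.IsStronglyCartesian.map (hoFfb C) f c (Category.id_comp f).symm χ,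
      Functor.IsStronglyCartesian.map_isHomLift (hoFfb C) f c
        (Category.id_comp f).symm χ⟩, trivial, fun m _ ↦ Subtype.ext ?_⟩
    have hm : (hoFfb C).IsHomLift f (m.1 ≫ c) := by
      simpa using (inferInstance : (hoFfb C).IsHomLift (𝟙 A ≫ f) (m.1 ≫ c))
    exact Functor.IsStronglyCartesian.map_uniq (hoFfb C) f c
      (Category.id_comp f).symm χ m.1 (h _ hm)
  exact ⟨IsTerminal.ofUniqueHom (fun S ↦ (H S).choose) (fun S m ↦ (H S).choose_spec.2 m trivial)⟩

/-- The pullback of `X` and `Y` over `B` is the product of `X` with the reindexing of `Y` along `f`.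
For `f = 𝟙 A` it gives products in a fiber; for general `f` it gives the domain in Frobenius
reciprocity without choosing a reindexing. -/
lemma isCartesianPair_of_isPullback {A B : FibrantObject C} (f : A ⟶ B) {X Y Z : C} {x : X ⟶ A.obj}
    {y : Y ⟶ B.obj} {t : Z ⟶ X} {s : Z ⟶ Y} [Fibration x] [Fibration y] [Fibration (t ≫ x)]
    (h : IsPullback t s (x ≫ f.hom) y) :
    IsCartesianPair (hoFfb C) (𝟙 A) f
      (squareHom (x := t ≫ x) (𝟙 A) t (Category.comp_id (t ≫ x)).symm)
      (squareHom (x := t ≫ x) f s (by rw [Category.assoc, h.w])) := by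
  refine isCartesianPair_squareHom _ _ _ _ _ _ (fun {W} a u₁ u₂ h₁ h₂ ↦ ?_)
  replace h₁ : u₁ ≫ x = a := h₁.trans (Category.comp_id a)
  have w : u₁ ≫ x ≫ f.hom = u₂ ≫ y := by rw [reassoc_of% h₁, h₂]
  refine ⟨h.lift u₁ u₂ w, ⟨by simpa, by simp, by simp⟩, fun u hu ↦ h.hom_ext ?_ ?_⟩
  · rw [hu.2.1, h.lift_fst]
  · rw [hu.2.2, h.lift_snd]

lemma exists_isCartesianPair {A : FibrantObject C} (P Q : (hoFfb C).Fiber A) :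
    ∃ (R : (hoFfb C).Fiber A) (π₁ : R ⟶ P) (π₂ : R ⟶ Q),
      IsCartesianPair (hoFfb C) (𝟙 A) (𝟙 A) π₁.1 π₂.1 := by
  obtain ⟨X, x, _, rfl⟩ := exists_eq_fiberMk P
  obtain ⟨Y, y, _, rfl⟩ := exists_eq_fiberMk Q
  have h := isCartesianPair_of_isPullback (𝟙 A)
    (IsPullback.of_hasPullback (x ≫ (𝟙 A : A ⟶ A).hom) y)
  exact ⟨_, ⟨_, h.isHomLift₁⟩, ⟨_, h.isHomLift₂⟩, h⟩

lemma isCartesianPair_of_isLimit {A : FibrantObject C} {P Q R : (hoFfb C).Fiber A} {π₁ : R ⟶ P}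
    {π₂ : R ⟶ Q} (h : Nonempty (IsLimit (BinaryFan.mk π₁ π₂))) :
    IsCartesianPair (hoFfb C) (𝟙 A) (𝟙 A) π₁.1 π₂.1 := by
  obtain ⟨R', π₁', π₂', h'⟩ := exists_isCartesianPair P Q
  exact h'.of_isLimit h

theorem isWedgeFibration_hoFfb : IsWedgeFibration (hoFfb C) where
  isFibered := inferInstance
  fiber_hasTerminal A := (isTerminalFiberMkId A).hasTerminal
  fiber_hasBinaryProducts A :=
    have (P Q : (hoFfb C).Fiber A) : HasLimit (pair P Q) := by
      obtain ⟨R, π₁, π₂, h⟩ := exists_isCartesianPair P Q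
      obtain ⟨h⟩ := h.isLimit
      exact ⟨_, h⟩
    hasBinaryProducts_of_hasLimit_pair _
  terminal_stable f T' T c hc hT := isTerminal_of_isStronglyCartesian f c hT.some
  product_stable f _ _ _ _ _ _ π₁ π₂ π₁' π₂' cP cQ cR _ _ _ comm₁ comm₂ hlim :=
    (isCartesianPair_of_isLimit hlim).isLimit_pullback f cP cQ cR comm₁ comm₂

/-! ## Frobenius reciprocity and stability -/

/-- With `q` given by a weak equivalence `t : X ⟶ X'`, the morphism `q ∧ c` is, up to isomorphism,
the induced map between the pullbacks of `X` and `X'` with `Y` over `B`. -/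
theorem satisfiesFrobenius (hC : RightProper C) {A B : FibrantObject C} (f : A ⟶ B)
    {Q : (hoFfb C).Fiber A} {Q' : (hoFfb C).Fiber B} (q : Q.1 ⟶ Q'.1)
    [(hoFfb C).IsStronglyCocartesian f q] : SatisfiesFrobenius (hoFfb C) f q := by
  intro P₀ R P R' c π₁ π₂ π₁' π₂' r hc hlim hlim' hr h₁ h₂
  obtain ⟨X, x, _, rfl⟩ := exists_eq_fiberMk Q
  obtain ⟨Y, y, _, rfl⟩ := exists_eq_fiberMk P
  obtain ⟨X', t, x', _, -, _, w⟩ := exists_trivialCofibration_fibration (x ≫ f.hom)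
  have := isStronglyCocartesian_squareHom f t w
  obtain ⟨e, he, hq⟩ := exists_iso_of_isStronglyCocartesian (p := hoFfb C) f (squareHom f t w) q
  have h := isCartesianPair_of_isPullback f (IsPullback.of_hasPullback (x ≫ f.hom) y)
  have sq' := IsPullback.of_hasPullback (x' ≫ (𝟙 B : B ⟶ B).hom) y
  have h' := isCartesianPair_of_isPullback (𝟙 B) sq'
  have hR := (isCartesianPair_of_isLimit hlim).comp_cartesian f c
  rw [Category.id_comp] at hR
  have hR' := isCartesianPair_of_isLimit hlim'
  obtain ⟨e₀, he₀, k₁, k₂⟩ := h.exists_iso hR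
  obtain ⟨e₁, he₁, l₁, l₂⟩ := hR'.exists_iso (h'.symm.comp_iso e.hom).symm
  have w' : t ≫ x' ≫ (𝟙 B : B ⟶ B).hom = x ≫ f.hom :=
    (congr_arg (t ≫ ·) (Category.comp_id x')).trans w
  let ρ : pullback (x ≫ f.hom) y ⟶ pullback (x' ≫ (𝟙 B : B ⟶ B).hom) y :=
    pullback.lift (pullback.fst _ _ ≫ t) (pullback.snd _ _)
      (by rw [Category.assoc, w', pullback.condition])
  have hρ₁ : ρ ≫ pullback.fst _ _ = pullback.fst _ _ ≫ t := pullback.lift_fst _ _ _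
  have hρ₂ : ρ ≫ pullback.snd _ _ = pullback.snd _ _ := pullback.lift_snd _ _ _
  have : WeakEquivalence ρ := by
    -- By pasting, `ρ` is the pullback of `t` along the projection to `X'`, a fibration because `y`
    -- is one.
    refine hC (IsPullback.of_right ?_ hρ₁ sq'.flip) inferInstance inferInstance
    rw [hρ₂, w']
    exact (IsPullback.of_hasPullback _ _).flip
  have hρ : ρ ≫ pullback.fst _ _ ≫ x' = (pullback.fst _ _ ≫ x) ≫ f.hom := by
    rw [reassoc_of% hρ₁, w, Category.assoc]
  have := isStronglyCocartesian_squareHom f ρ hρ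
  have H := isStronglyCocartesian_iso_comp_iso (p := hoFfb C) f e₀ (squareHom f ρ hρ) e₁
  convert H using 1
  -- The given `r` agrees with the constructed morphism because both have the same composites with
  -- the two projections of `R'`.
  refine hR'.hom_ext f (h₁.trans ?_) (h₂.trans ?_)
  · simp only [Category.assoc, l₁, ← hq]
    refine (congr_arg (· ≫ squareHom f t w ≫ e.hom) k₁.symm).trans ?_
    simp only [Category.assoc]
    congr 1
    rw [← Category.assoc, ← Category.assoc,
      squareHom_comp_eq (h := f) (s := pullback.fst _ _ ≫ t) (w'' := by simp [w]) rfl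
        (Category.id_comp f),
      squareHom_comp_eq (h := f) (s := pullback.fst _ _ ≫ t) (w'' := by simp [w]) hρ₁
        (Category.comp_id f)]
  · simp only [Category.assoc, l₂]
    exact k₂.symm.trans (congr_arg (e₀.hom ≫ ·) (squareHom_comp_eq hρ₂ (Category.comp_id f)).symm)

/-- With `q` given by a weak equivalence `i : X ⟶ X'`, the morphism `q'` is, up to isomorphism,
given by the pullback of `i` along the projection from the pullback of `X'` and `B` to `X'`. That
projection is a fibration because `k` is. -/
theorem isStableAlong (hC : RightProper C) {D E : FibrantObject C} (g : D ⟶ E) {P Q : HoFibArrow C}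
    (q : P ⟶ Q) [(hoFfb C).IsStronglyCocartesian g q] {B : FibrantObject C} (k : B ⟶ E)
    (hk : IsProductProjection k) : IsStableAlong (hoFfb C) g q k := by
  intro A f h sq P' Q' q' s t hq' hs ht comm
  have := fibration_of_isProductProjection hk
  have sq₀ := isPullback_hom_of_fibration sq
  have : Fibration h.hom := by
    rw [fibration_iff]
    exact MorphismProperty.of_isPullback sq₀ ((fibration_iff _).1 inferInstance)
  obtain ⟨X, x, _, hP⟩ := exists_eq_fiberMk (⟨P, IsHomLift.domain_eq (hoFfb C) g q⟩ : (hoFfb C).Fiber D)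
  obtain rfl : P = (fiberMk x).1 := congr_arg Subtype.val hP
  obtain ⟨X', i, x', _, -, _, w⟩ := exists_trivialCofibration_fibration (x ≫ g.hom)
  have := isStronglyCocartesian_squareHom g i w
  obtain ⟨e, he, hq⟩ := exists_iso_of_isStronglyCocartesian (p := hoFfb C) g (squareHom g i w) q
  have sqX := IsPullback.of_hasPullback x h.hom
  have sqX' := IsPullback.of_hasPullback x' k.hom
  have c := isStronglyCartesian_squareHom h _ sqX
  have c' := isStronglyCartesian_squareHom k _ sqX'
  have c'' : (hoFfb C).IsStronglyCartesian k (squareHom k _ sqX'.w ≫ e.hom) := by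
    simpa using (inferInstance :
      (hoFfb C).IsStronglyCartesian (k ≫ 𝟙 E) (squareHom k _ sqX'.w ≫ e.hom))
  obtain ⟨e₀, he₀, k₀⟩ := exists_iso_of_isStronglyCartesian (p := hoFfb C) h
    (squareHom h _ sqX.w) s
  obtain ⟨e₁, he₁, k₁⟩ := exists_iso_of_isStronglyCartesian (p := hoFfb C) k t
    (squareHom k _ sqX'.w ≫ e.hom)
  have big := sqX.flip.paste_horiz sq₀
  rw [← w] at big
  let ρ := sqX'.lift (pullback.fst x h.hom ≫ i) (pullback.snd x h.hom ≫ f.hom)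
    (by rw [Category.assoc, big.w])
  have hρ₁ : ρ ≫ pullback.fst _ _ = pullback.fst _ _ ≫ i := sqX'.lift_fst _ _ _
  have hρ₂ : ρ ≫ pullback.snd _ _ = pullback.snd _ _ ≫ f.hom := sqX'.lift_snd _ _ _
  have : WeakEquivalence ρ := by
    rw [← hρ₂] at big
    exact hC (IsPullback.of_right big hρ₁ sqX'.flip) inferInstance inferInstance
  have := isStronglyCocartesian_squareHom f ρ hρ₂
  have H := isStronglyCocartesian_iso_comp_iso (p := hoFfb C) f e₀ (squareHom f ρ hρ₂) e₁
  convert H using 1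
  refine Functor.IsStronglyCartesian.ext (hoFfb C) k t f (comm.trans ?_)
  have w₀ : (pullback.fst x h.hom ≫ i) ≫ x' = pullback.snd x h.hom ≫ (f ≫ k).hom := by
    rw [← hρ₁, Category.assoc, sqX'.w, reassoc_of% hρ₂]
    rfl
  have : squareHom f ρ hρ₂ ≫ squareHom k _ sqX'.w = squareHom h _ sqX.w ≫ squareHom g i w :=
    (squareHom_comp_eq (w'' := w₀) hρ₁ rfl).trans (squareHom_comp_eq rfl sq.w.symm).symm
  simp only [Category.assoc, k₁, ← k₀, ← hq, reassoc_of% this]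

theorem isWedgeEqFibration_hoFfb (hC : RightProper C) : IsWedgeEqFibration (hoFfb C) where
  base_hasTerminal := inferInstance
  base_hasBinaryProducts := inferInstance
  isWedgeFibration := isWedgeFibration_hoFfb
  exists_cocartesian d _ T _ := by
    obtain ⟨X, x, _, rfl⟩ := exists_eq_fiberMk T
    obtain ⟨X', t, x', _, -, _, w⟩ := exists_trivialCofibration_fibration (x ≫ d.hom)
    exact ⟨fiberMk x', squareHom d t w, isStronglyCocartesian_squareHom d t w⟩
  frobenius d _ _ _ _ ρ _ := satisfiesFrobenius hC d ρ
  stable d _ _ _ _ ρ _ _ k hk := isStableAlong hC d ρ k hk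

end HoFib

/-! ## The fibers as homotopy categories of slices -/

namespace HoFib

open VerticalModelStructure

variable {C : Type u} [Category.{v} C] [ModelCategory C]

lemma isCofibrant_left_of_over {A : C} (X : Over A) [IsCofibrant X] : IsCofibrant X.left := by
  have hi : IsInitial (Over.mk (initial.to A)) := IsInitial.ofUniqueHom
    (fun Y ↦ Over.homMk (initial.to Y.left) (initial.hom_ext _ _))
    (fun Y m ↦ Over.OverMorphism.ext (initial.hom_ext _ _))
  have : Cofibration (hi.to X) := (isCofibrant_iff_of_isInitial _ hi).1 inferInstance
  exact (isCofibrant_iff_of_isInitial (hi.to X).left initialIsInitial).2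
    inferInstance

lemma isCofibrant_arrow (P : Arrow C) [IsCofibrant P.left] : IsCofibrant P := by
  have hi : IsInitial (Arrow.mk (𝟙 (⊥_ C))) := IsInitial.ofUniqueHom
    (fun Q ↦ Arrow.homMk (initial.to Q.left) (initial.to Q.right) (initial.hom_ext _ _))
    (fun Q m ↦ Arrow.hom_ext _ _ (initial.hom_ext _ _) (initial.hom_ext _ _))
  rw [isCofibrant_iff_of_isInitial (hi.to P) hi, arrow_cofibration_iff]
  exact (isCofibrant_iff_of_isInitial (hi.to P).left initialIsInitial).1 inferInstance

variable {A : FibrantObject C}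

lemma isIso_toFiber_map {X Y : FibrantObject (Over A.obj)} (φ : X ⟶ Y) [WeakEquivalence φ.hom] :
    IsIso ((toFiber A).map φ) := by
  have : WeakEquivalence ((sliceInclusion A).map φ).hom :=
    (arrow_weakEquivalence_iff _).2
      ⟨inferInstanceAs (WeakEquivalence φ.hom.left), inferInstanceAs (IsIso (𝟙 A.obj))⟩
  obtain ⟨ψ, h₁, h₂⟩ := isIso_gammaFb_map ((sliceInclusion A).map φ)
  let e : ((toFiber A).obj X).1 ≅ ((toFiber A).obj Y).1 := ⟨((toFiber A).map φ).1, ψ, h₁, h₂⟩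
  have : (hoFfb C).IsHomLift (𝟙 A) e.hom := ((toFiber A).map φ).2
  exact ⟨⟨ψ, IsHomLift.lift_id_inv (hoFfb C) A e⟩, Subtype.ext h₁, Subtype.ext h₂⟩

lemma toFiber_map_surjective {X Y : FibrantObject (Over A.obj)} [IsCofibrant X.obj]
    (χ : (toFiber A).obj X ⟶ (toFiber A).obj Y) : ∃ φ : X ⟶ Y, (toFiber A).map φ = χ := by
  have := isCofibrant_left_of_over X.obj
  have : IsCofibrant ((sliceInclusion A).obj X).obj.left := this
  have := isCofibrant_arrow ((sliceInclusion A).obj X).obj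
  obtain ⟨ρ, hρ⟩ := gammaFb_map_surjective (P := (sliceInclusion A).obj X)
    (Q := (sliceInclusion A).obj Y) χ.1
  have h : ρ.hom.right = 𝟙 A.obj := by
    rw [← base_gammaFb_map, hρ]
    exact (isHomLift_hoFfb_iff (P := (sliceInclusion A).obj X) (Q := (sliceInclusion A).obj Y)
      (𝟙 A) _).1 χ.2
  refine ⟨ObjectProperty.homMk (Over.homMk ρ.hom.left ?_), Subtype.ext (Eq.trans ?_ hρ)⟩
  · exact (Arrow.w ρ.hom).trans ((congr_arg (X.obj.hom ≫ ·) h).trans (Category.comp_id _))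
  · exact congr_arg (gammaFb C).map (ObjectProperty.hom_ext _ (Arrow.hom_ext _ _ rfl h.symm))

/-- The codomain part of a cylinder projection is invertible, so composing `Z.I.hom` with it turns a
homotopy of arrows into one over `A`. Both inclusions are sections of a weak equivalence, so `L`
identifies them. -/
lemma map_eq_of_toFiber_map_eq {H : Type*} [Category* H] (L : Over A.obj ⥤ H)
    [L.IsLocalization (weakEquivalences (Over A.obj))] {X Y : FibrantObject (Over A.obj)}
    [IsCofibrant X.obj] {σ σ' : X ⟶ Y} (h : (toFiber A).map σ = (toFiber A).map σ') :
    L.map σ.hom = L.map σ'.hom := by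
  have := isCofibrant_left_of_over X.obj
  have : IsCofibrant ((sliceInclusion A).obj X).obj.left := this
  have := isCofibrant_arrow ((sliceInclusion A).obj X).obj
  obtain ⟨Z, ⟨h⟩⟩ := (gammaFb_map_eq_iff ((sliceInclusion A).map σ) ((sliceInclusion A).map σ')).1
    (congr_arg Subtype.val h)
  let r : Z.I.right ⟶ A.obj := Z.π.right
  let I : Over A.obj := Over.mk (Z.I.hom ≫ r)
  have w₀ : Z.i₀.right ≫ r = 𝟙 A.obj := congr_arg Arrow.Hom.right Z.i₀_π
  have w₁ : Z.i₁.right ≫ r = 𝟙 A.obj := congr_arg Arrow.Hom.right Z.i₁_π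
  let i₀ : X.obj ⟶ I := Over.homMk Z.i₀.left ((Category.assoc _ _ _).symm.trans
    ((congr_arg (· ≫ r) (Arrow.w Z.i₀)).trans ((Category.assoc _ _ _).trans
      ((congr_arg (X.obj.hom ≫ ·) w₀).trans (Category.comp_id _)))))
  let i₁ : X.obj ⟶ I := Over.homMk Z.i₁.left ((Category.assoc _ _ _).symm.trans
    ((congr_arg (· ≫ r) (Arrow.w Z.i₁)).trans ((Category.assoc _ _ _).trans
      ((congr_arg (X.obj.hom ≫ ·) w₁).trans (Category.comp_id _)))))
  let π : I ⟶ X.obj := Over.homMk Z.π.left (Arrow.w Z.π)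
  let k : I ⟶ Y.obj := Over.homMk h.h.left ((Arrow.w h.h).trans (congr_arg (Z.I.hom ≫ ·)
    ((leftHomotopy_right h).trans (Category.comp_id r))))
  have : WeakEquivalence π :=
    (weakEquivalences_over_iff _ π).2 (inferInstanceAs (WeakEquivalence Z.π.left))
  have := isIso_map_of_weakEquivalence L π
  have e₀ : i₀ ≫ π = 𝟙 _ := Over.OverMorphism.ext (congr_arg Arrow.Hom.left Z.i₀_π)
  have e₁ : i₁ ≫ π = 𝟙 _ := Over.OverMorphism.ext (congr_arg Arrow.Hom.left Z.i₁_π)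
  have k₀ : i₀ ≫ k = σ.hom := Over.OverMorphism.ext (congr_arg Arrow.Hom.left h.h₀)
  have k₁ : i₁ ≫ k = σ'.hom := Over.OverMorphism.ext (congr_arg Arrow.Hom.left h.h₁)
  have e : L.map i₀ = L.map i₁ := by
    rw [← cancel_mono (L.map π), ← L.map_comp, ← L.map_comp, e₀, e₁]
  rw [← k₀, ← k₁, L.map_comp, L.map_comp, e]

/-- The induced functor `F` from the localization of the fibrant objects of `C/A` to the fiber is an
equivalence. Fullness and faithfulness are tested on cofibrant resolutions, where morphisms on both
sides are represented by maps over `A`. -/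
theorem isLocalization_toFiber (A : FibrantObject C) :
    (toFiber A).IsLocalization (weakEquivalences (FibrantObject (Over A.obj))) := by
  let L₀ := (weakEquivalences (Over A.obj)).Q
  let L := FibrantObject.ι ⋙ L₀
  have hW : (weakEquivalences (FibrantObject (Over A.obj))).IsInvertedBy (toFiber A) :=
    fun X Y φ hφ ↦ have : WeakEquivalence φ.hom := ⟨hφ⟩; isIso_toFiber_map φ
  let F := Localization.lift (toFiber A) hW L
  let e : L ⋙ F ≅ toFiber A := Localization.fac (toFiber A) hW L
  have : L.EssSurj := Localization.essSurj L (weakEquivalences (FibrantObject (Over A.obj)))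
  have he {X Y : FibrantObject (Over A.obj)} (φ : X ⟶ Y) :
      F.map (L.map φ) = e.hom.app X ≫ (toFiber A).map φ ≫ e.inv.app Y := by
    rw [← NatIso.naturality_1 e φ]
    simp
  have resolution (X : FibrantObject (Over A.obj)) : ∃ (X' : FibrantObject (Over A.obj))
      (w : X' ⟶ X), IsCofibrant X'.obj ∧ IsIso (L.map w) := by
    obtain ⟨X', _, w, _, _⟩ := CofibrantObject.HoCat.exists_resolution X.obj
    exact ⟨⟨X', isFibrant_of_fibration w⟩, ObjectProperty.homMk w, ‹_›,
      isIso_map_of_weakEquivalence L₀ w⟩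
  have : F.Faithful := F.faithful_of_comp_essSurj L (fun X Y a b hab ↦ by
    obtain ⟨X', w, _, _⟩ := resolution X
    obtain ⟨σ, hσ⟩ := map_surjective_of_isLocalization L₀ X'.obj Y.obj (L.map w ≫ a)
    obtain ⟨τ, hτ⟩ := map_surjective_of_isLocalization L₀ X'.obj Y.obj (L.map w ≫ b)
    have h : (toFiber A).map (ObjectProperty.homMk σ : X' ⟶ Y) =
        (toFiber A).map (ObjectProperty.homMk τ : X' ⟶ Y) := by
      rw [← cancel_epi (e.hom.app X'), ← cancel_mono (e.inv.app Y), Category.assoc, Category.assoc,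
        ← he, ← he]
      change F.map (L₀.map σ) = F.map (L₀.map τ)
      rw [hσ, hτ, F.map_comp, F.map_comp, hab]
    rw [← cancel_epi (L.map w), ← hσ, ← hτ]
    exact map_eq_of_toFiber_map_eq L₀ h)
  have : F.Full := F.full_of_comp_essSurj L (fun X Y χ ↦ by
    obtain ⟨X', w, _, _⟩ := resolution X
    obtain ⟨φ, hφ⟩ := toFiber_map_surjective
      (e.inv.app X' ≫ F.map (L.map w) ≫ χ ≫ e.hom.app Y)
    refine ⟨inv (L.map w) ≫ L.map φ, ?_⟩
    rw [← cancel_epi (F.map (L.map w)), ← F.map_comp, IsIso.hom_inv_id_assoc, he, hφ]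
    simp)
  have : F.EssSurj := ⟨fun P ↦ by
    obtain ⟨X, x, _, rfl⟩ := exists_eq_fiberMk P
    have hx : IsFibrant (Over.mk x) :=
      (isFibrant_iff_of_isTerminal (Over.homMk x : Over.mk x ⟶ Over.mk (𝟙 A.obj))
        Over.mkIdTerminal).2 ((fibrations_over_iff _ _).2 ‹_›)
    exact ⟨L.obj ⟨Over.mk x, hx⟩, ⟨e.app _⟩⟩⟩
  have : F.IsEquivalence := { }
  exact Functor.IsLocalization.of_equivalence_target L _ (toFiber A) F.asEquivalence e

end HoFib

theorem theorem4p6p6 {C : Type u} [Category.{v} C] [ModelCategory C]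
    (hC : HoFib.RightProper C) :
    -- `HoF_fb(C_fb)` is a `∧₌`-fibration
    WedgeFib.IsWedgeEqFibration (HoFib.hoFfb C) ∧
    -- its fiber over `A` is the homotopy category of the fibrant objects of `C/A`
    (∀ A : FibrantObject C,
      (HoFib.toFiber A).IsLocalization (weakEquivalences (FibrantObject (Over A.obj)))) ∧
    -- every `f : A ⟶ B` has, at every object over `A`, a cocartesian lift given by a weak equivalence
    (∀ (P : HoFib.FibArrow C) {B : FibrantObject C} (f : (HoFib.codFib C).obj P ⟶ B),
      ∃ (Q : HoFib.FibArrow C) (φ : P ⟶ Q), (HoFib.codFib C).IsHomLift f φ ∧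
        WeakEquivalence φ.hom.left ∧
        (HoFib.hoFfb C).IsStronglyCocartesian f ((HoFib.gammaFb C).map φ)) ∧
    -- the class of a morphism of arrows is cocartesian iff its domain part is a weak equivalence
    (∀ {P Q : HoFib.FibArrow C} (φ : P ⟶ Q),
      (HoFib.hoFfb C).IsStronglyCocartesian ((HoFib.codFib C).map φ) ((HoFib.gammaFb C).map φ) ↔
        WeakEquivalence φ.hom.left) ∧
    -- all cocartesian morphisms satisfy Frobenius reciprocity
    (∀ {A B : FibrantObject C} (f : A ⟶ B) {Q : (HoFib.hoFfb C).Fiber A}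
      {Q' : (HoFib.hoFfb C).Fiber B} (q : Q.1 ⟶ Q'.1),
      (HoFib.hoFfb C).IsStronglyCocartesian f q →
        WedgeFib.SatisfiesFrobenius (HoFib.hoFfb C) f q) ∧
    -- all cocartesian morphisms are stable along product projections
    (∀ {D E : FibrantObject C} (g : D ⟶ E) {P Q : HoFib.HoFibArrow C} (q : P ⟶ Q),
      (HoFib.hoFfb C).IsStronglyCocartesian g q →
        ∀ {B : FibrantObject C} (k : B ⟶ E), WedgeFib.IsProductProjection k →
          WedgeFib.IsStableAlong (HoFib.hoFfb C) g q k) :=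
  ⟨HoFib.isWedgeEqFibration_hoFfb hC, HoFib.isLocalization_toFiber,
    fun P _ f ↦ HoFib.exists_cocartesian_lift P f,
    fun φ ↦ HoFib.isStronglyCocartesian_gammaFb_map_iff φ,
    fun f _ _ q _ ↦ HoFib.satisfiesFrobenius hC f q,
    fun g _ _ q _ _ k hk ↦ HoFib.isStableAlong hC g q k hk⟩
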